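/- **Setting.** Let $N\ge 4$ and $2\le N'\le N-2$. A lower triangular matrix $H=(h_{k,j})\in\mathbb R^{(N-1)\times(N-1)}$ represents the algorithm $$y_{k+1}=y_k-\sum_{j=0}^{k}h_{k+1,j+1}\,(y_j-Ty_j),\qquad k=0,\dots,N-2,$$ for nonexpansive $T:\mathbb R^d\to\mathbb R^d$. For $1\le k\le N-1$ put $$P(k,m;H)=\sum_{1\le j(1)\le i(1)<j(2)\le i(2)<\dots<j(m)\le i(m)\le k}\ \prod_{r=1}^m h_{i(r),j(r)},$$ and let $Q(k,m,j;H)$ be the part of this sum with $j(1)=j$. $H$ is *H-invariant* if $P(N-1,m;H)=\frac1N\binom{N}{m+1}$ for $m=1,\dots,N-1$. The *H-certificates* $\lambda^\star_{k,j}(H)$, $1\le j<k\le N$, of an H-invariant $H$ are the unique reals $\lambda_{k,j}$ for which $$0=N\|g_N\|^2+\langle g_N,x_N-y_0\rangle+\sum_{k=1}^N\sum_{j=1}^{k-1}\lambda_{k,j}\langle x_k-x_j,g_k-g_j\rangle$$ holds identically in the vectors $y_0,g_1,\dots,g_N$ (of any $\mathbb R^d$), where $y_k=y_{k-1}-\sum_{j=1}^{k}2h_{k,j}g_j$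 and $x_k=y_{k-1}-g_k$. Column $j$ is *top-sparse* if $\lambda^\star_{k,j}(H)=0$ for $j+2\le k\le N$, and *bottom-sparse* if $\lambda^\star_{k,j}(H)=0$ for $j+1\le k\le N-1$. **Proposition.** 1. For every H-invariant lower triangular $H$ the H-certificates exist and are unique. 2. A lower triangular $H$ is H-invariant, top-sparse in columns $j=1,\dots,N'-1$ and bottom-sparse in columns $j=N',\dots,N-1$ if and only if, for all $1\le j\le N-1$ and $1\le k\le N-j$, $$Q(N-1,k,j;H)=\begin{cases}\frac{j}{N}\binom{N-j-1}{k-1}, & j=1,\dots,N'-1,\\[2pt] \frac{N'(N-N'+1)}{N(k+1)}\binom{N-N'-1}{k-1}, & j=N',\\[2pt] \frac1{k+1}\binom{N-j-1}{k-1}, & j=N'+1,\dots,N-1.\end{cases}$$ 3. There is exactly one lower triangular $H$ with this Q-function profile. 4. For that $H$, $\lambda^\star_{j+1,j}(H)>0$ for $j=1,\dots,N'-1$ and $\lambda^\star_{N,j}(H)>0$ for $j=N',\dots,N-1$, and $H$ is minimax optimal, that is: - for every $d$, every nonexpansive $T:\mathbb R^d\to\mathbb R^d$, every $y_0$ and every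 fixed point $y_\star$ of $T$, $\|y_{N-1}-Ty_{N-1}\|^2\le \frac{4\|y_0-y_\star\|^2}{N^2}$; - for every $d\ge 2(N-1)$, the supremum of $\|y_{N-1}-Ty_{N-1}\|^2/\|y_0-y_\star\|^2$ over all nonexpansive $T:\mathbb R^d\to\mathbb R^d$, all $y_0\in\mathbb R^d$ and all fixed points $y_\star\neq y_0$ of $T$ equals $\frac4{N^2}$ for the algorithm $H$, and no deterministic first-order algorithm on $\mathbb R^d$ (one that computes $y_{k+1}$ as a function of $y_0,\dots,y_k,Ty_0,\dots,Ty_k$) has a smaller supremum. -/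

import Mathlib

open scoped BigOperators

noncomputable section

/-! ### H-matrices, H-invariants and Q-functions -/

/-- A real `(N-1) × (N-1)` matrix, the step sizes of an algorithm with `N-1` steps. -/
abbrev HMatrix (N : ℕ) := Matrix (Fin (N - 1)) (Fin (N - 1)) ℝ

/-- The entry `h_{k,j}` with the usual indices `1 ≤ k, j ≤ N-1` (and `0` outside that range). -/
def HMatrix.entry {N : ℕ} (H : HMatrix N) (k j : ℕ) : ℝ :=
  if hkj : (1 ≤ k ∧ k ≤ N - 1) ∧ (1 ≤ j ∧ j ≤ N - 1) then
    H ⟨k - 1, by omega⟩ ⟨j - 1, by omega⟩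
  else 0

/-- `H` is lower triangular. -/
def HMatrix.IsLower {N : ℕ} (H : HMatrix N) : Prop :=
  ∀ k j : Fin (N - 1), k < j → H k j = 0

/-- The index sequences `(i(1), j(1)), …, (i(m), j(m))` with
`1 ≤ j(1) ≤ i(1) < j(2) ≤ i(2) < ⋯ < j(m) ≤ i(m) ≤ k`;
the `r`-th pair `(i(r), j(r))` of `c` is `((c r).1, (c r).2)`. -/
def chains (k m : ℕ) : Finset (Fin m → ℕ × ℕ) :=
  {c ∈ Fintype.piFinset (fun _ : Fin m => Finset.Icc 1 k ×ˢ Finset.Icc 1 k) |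
    (∀ r, (c r).2 ≤ (c r).1) ∧ ∀ r s : Fin m, (r : ℕ) + 1 = s → (c r).1 < (c s).2}

/-- `P(k, m; H) = ∑ ∏_r h_{i(r), j(r)}` over all index sequences of length `m` bounded by `k`. -/
def HMatrix.P {N : ℕ} (H : HMatrix N) (k m : ℕ) : ℝ :=
  ∑ c ∈ chains k m, ∏ r, H.entry (c r).1 (c r).2

/-- `Q(k, m, j; H)`: the part of `P(k, m; H)` whose smallest column index `j(1)` equals `j`. -/
def HMatrix.Q {N : ℕ} (H : HMatrix N) (k m j : ℕ) : ℝ :=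
  ∑ c ∈ chains k m with ∀ r : Fin m, (r : ℕ) = 0 → (c r).2 = j,
    ∏ r, H.entry (c r).1 (c r).2

/-- The H-invariance conditions `P(N-1, m; H) = (1/N) * binom(N, m+1)` for `m = 1, …, N-1`. -/
def HMatrix.IsInvariant {N : ℕ} (H : HMatrix N) : Prop :=
  ∀ m : ℕ, 1 ≤ m → m ≤ N - 1 → H.P (N - 1) m = 1 / (N : ℝ) * (N.choose (m + 1) : ℝ)

/-! ### H-certificates -/

/-- The formal iterates `y_0, y_1, …` built from `y_0` and vectors `g_1, g_2, …` by
`y_{k+1} = y_k - ∑_{j=0}^{k} 2 h_{k+1,j+1} g_{j+1}`. -/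
def HMatrix.formalY {N d : ℕ} (H : HMatrix N) (y₀ : EuclideanSpace ℝ (Fin d))
    (g : ℕ → EuclideanSpace ℝ (Fin d)) : ℕ → EuclideanSpace ℝ (Fin d)
  | 0 => y₀
  | k + 1 => H.formalY y₀ g k -
      ∑ j ∈ Finset.range (k + 1), (2 * H.entry (k + 1) (j + 1)) • g (j + 1)

/-- `x_k = y_{k-1} - g_k` for `k ≥ 1`. -/
def HMatrix.formalX {N d : ℕ} (H : HMatrix N) (y₀ : EuclideanSpace ℝ (Fin d))
    (g : ℕ → EuclideanSpace ℝ (Fin d)) (k : ℕ) : EuclideanSpace ℝ (Fin d) :=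
  H.formalY y₀ g (k - 1) - g k

/-- `lam` is a family of multipliers `lam k j`, `1 ≤ j < k ≤ N` (extended by `0`), for which
`0 = N‖g_N‖² + ⟪g_N, x_N - y_0⟫ + ∑_{k=1}^N ∑_{j=1}^{k-1} lam k j * ⟪x_k - x_j, g_k - g_j⟫`
holds identically in the vector variables `g_1, …, g_N` (and `y_0`). -/
def HMatrix.IsCertificate {N : ℕ} (H : HMatrix N) (lam : ℕ → ℕ → ℝ) : Prop :=
  (∀ k j : ℕ, ¬ (1 ≤ j ∧ j < k ∧ k ≤ N) → lam k j = 0) ∧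
  ∀ (d : ℕ) (y₀ : EuclideanSpace ℝ (Fin d)) (g : ℕ → EuclideanSpace ℝ (Fin d)),
    0 = (N : ℝ) * ‖g N‖ ^ 2 + inner ℝ (g N) (H.formalX y₀ g N - y₀) +
      ∑ k ∈ Finset.Icc 1 N, ∑ j ∈ Finset.Icc 1 (k - 1),
        lam k j * inner ℝ (H.formalX y₀ g k - H.formalX y₀ g j) (g k - g j)

open Classical in
/-- The H-certificates `λ*_{k,j}(H)`: the unique multipliers satisfying the identity above
(a junk value if they are not uniquely determined). -/
def HMatrix.certificate {N : ℕ} (H : HMatrix N) : ℕ → ℕ → ℝ :=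
  if hu : ∃! lam, H.IsCertificate lam then hu.exists.choose else 0

/-- Top-sparsity in column `j`: `λ*_{j+2,j} = ⋯ = λ*_{N,j} = 0`. -/
def HMatrix.TopSparse {N : ℕ} (H : HMatrix N) (j : ℕ) : Prop :=
  ∀ k : ℕ, j + 2 ≤ k → k ≤ N → H.certificate k j = 0

/-- Bottom-sparsity in column `j`: `λ*_{j+1,j} = ⋯ = λ*_{N-1,j} = 0`. -/
def HMatrix.BottomSparse {N : ℕ} (H : HMatrix N) (j : ℕ) : Prop :=
  ∀ k : ℕ, j + 1 ≤ k → k ≤ N - 1 → H.certificate k j = 0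

/-- The explicit value prescribed for `Q(N-1, k, j)`, where `1 ≤ j ≤ N-1` and `1 ≤ k ≤ N-j`. -/
def profileQ (N N' k j : ℕ) : ℝ :=
  if j < N' then (j : ℝ) / N * ((N - j - 1).choose (k - 1) : ℝ)
  else if j = N' then
    ((N' : ℝ) * ((N : ℝ) - N' + 1)) / ((N : ℝ) * ((k : ℝ) + 1)) *
      ((N - N' - 1).choose (k - 1) : ℝ)
  else 1 / ((k : ℝ) + 1) * ((N - j - 1).choose (k - 1) : ℝ)

/-- The Q-functions of `H` have the explicit values `profileQ N N'`. -/
def HMatrix.HasProfile {N : ℕ} (H : HMatrix N) (N' : ℕ) : Prop :=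
  ∀ j k : ℕ, 1 ≤ j → j ≤ N - 1 → 1 ≤ k → k ≤ N - j → H.Q (N - 1) k j = profileQ N N' k j

/-! ### Algorithms, worst-case performance and minimax optimality -/

/-- A nonexpansive fixed-point problem on `ℝ^d`: a nonexpansive operator, a starting point
and a fixed point different from the starting point. -/
structure FixedPointProblem (d : ℕ) where
  T : EuclideanSpace ℝ (Fin d) → EuclideanSpace ℝ (Fin d)
  nonexpansive : LipschitzWith 1 T
  y₀ : EuclideanSpace ℝ (Fin d)
  yStar : EuclideanSpace ℝ (Fin d)
  fixed : T yStar = yStar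
  start_ne : y₀ ≠ yStar

/-- A deterministic first-order algorithm on `ℝ^d`: the map number `k` computes `y_{k+1}`
from the pairs `(y_0, T y_0), …, (y_k, T y_k)`. -/
def DetAlgorithm (d : ℕ) :=
  (k : ℕ) → (Fin (k + 1) → EuclideanSpace ℝ (Fin d) × EuclideanSpace ℝ (Fin d)) →
    EuclideanSpace ℝ (Fin d)

/-- The iterates `y_0, y_1, …` of a deterministic algorithm run on `T` from `y_0`. -/
def DetAlgorithm.iterate {d : ℕ} (A : DetAlgorithm d)
    (T : EuclideanSpace ℝ (Fin d) → EuclideanSpace ℝ (Fin d))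
    (y₀ : EuclideanSpace ℝ (Fin d)) : ℕ → EuclideanSpace ℝ (Fin d)
  | 0 => y₀
  | k + 1 => A k (fun i : Fin (k + 1) => (A.iterate T y₀ i, T (A.iterate T y₀ i)))
termination_by k => k
decreasing_by all_goals exact i.isLt

/-- The worst case of `‖y_{N-1} - T y_{N-1}‖² / ‖y_0 - y_*‖²` over all nonexpansive
fixed-point problems on `ℝ^d`. -/
def DetAlgorithm.worstCase {d : ℕ} (A : DetAlgorithm d) (N : ℕ) : ENNReal :=
  ⨆ p : FixedPointProblem d,
    ENNReal.ofReal
      (‖A.iterate p.T p.y₀ (N - 1) - p.T (A.iterate p.T p.y₀ (N - 1))‖ ^ 2 /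
        ‖p.y₀ - p.yStar‖ ^ 2)

/-- The algorithm `y_{k+1} = y_k - ∑_{j=0}^{k} h_{k+1,j+1} (y_j - T y_j)` represented by `H`. -/
def HMatrix.toAlgorithm {N : ℕ} (H : HMatrix N) (d : ℕ) : DetAlgorithm d :=
  fun k p => (p (Fin.last k)).1 -
    ∑ j : Fin (k + 1), H.entry (k + 1) ((j : ℕ) + 1) • ((p j).1 - (p j).2)

/-- The algorithm `A` solves `min_A max_p M(A, p; N)` over all deterministic first-order
algorithms on `ℝ^d` using `N-1` evaluations of the operator to produce `y_{N-1}`. -/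
def DetAlgorithm.IsMinimaxOptimal {d : ℕ} (A : DetAlgorithm d) (N : ℕ) : Prop :=
  ∀ B : DetAlgorithm d, A.worstCase N ≤ B.worstCase N

end

/-!
Write `A = (a_{k,j})` for the strictly lower triangular `N × N` matrix of partial column sums
`a_{k,j} = h_{j,j} + ⋯ + h_{k-1,j}`, and `L = 1 + 2 A`, so that `x_k = y_0 - (L g)_k`. The numbers
`Q(N-1, m, j; H)` are the entries of the row vectors `e_Nᵀ A^m` (`HMatrix.Q_eq_krylov`). Collecting
them into the column polynomials `r_j(X) = ∑ m, (e_Nᵀ A^m)_j (X - 1)^m` (`HMatrix.colPoly`) gives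
`r_N = 1` and `r_j = (X - 1) ∑_{k > j} a_{k,j} r_k` for `j < N`, with `r_j` of degree at
most `N - j`. Polynomials carry the Euclidean inner product of their coefficient vectors.

*Certificates.* A certificate is a weighted graph Laplacian `Λ` for which `M = Λ + e_N e_Nᵀ` solves
the Lyapunov equation `Lᵀ M + M L = 2 N e_N e_Nᵀ`. As `A` is nilpotent, the solution is unique
(`HMatrix.isCertificate_unique`), and it is `M = N (⟨r_k, r_j⟩)_{k,j}`: setting `W = ∑ g_j w_j`, where
`r_j = (X - 1) w_j` for `j < N` and `w_N = 0`, the equation reads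
`⟨(X + 1) W + g_N, (X - 1) W + g_N⟩ = g_N²`, which holds because multiplication by `X` is an
isometry (`HMatrix.coeffDot_sum_sum`). It remains that the row sums of `M` are those of `e_N e_Nᵀ`.
H-invariance says exactly that `∑_j r_j = (1 + X + ⋯ + X^{N-1}) / N`
(`HMatrix.isInvariant_iff_sum_colPoly`), and the inner product with this polynomial is evaluation at
`1` divided by `N`.

*Sparsity.* Vanishing of certificates is thus orthogonality of the `r_j`. Under H-invariance `r_j` has
exact degree `N - j` and vanishes at `1` for `j < N`. Top-sparsity of column `j` makes `r_j`
orthogonal to all polynomials of degree at most `N - j - 2`, so `r_j` is a multiple of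
`X^{N-j} - X^{N-j-1}`. Bottom-sparsity makes it orthogonal to the polynomials of degree less than
`N - j` vanishing at `1`, so it is a multiple of `E_{N-j+1} - E_{N-j}`, where
`E_n = (1 + ⋯ + X^{n-1}) / n`. The sum of the `r_j` fixes the scalars, since the degrees are distinct.
Taylor expansion at `1` turns these polynomials into the prescribed binomial values
(`taylor_targetPoly_coeff`), and their inner products give the signs of the certificates. Conversely,
polynomials of these exact degrees are the `r_j` of a unique `H`, since `A` is recovered by expanding
`r_j / (X - 1)` in the basis `r_{j+1}, …, r_N`.

*Optimality.* With nonnegative multipliers the certificate identity yields the upper bound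
(`HMatrix.IsCertificate.norm_sub_sq_le`). For the lower bound, a resisting oracle answers with the
cyclic isometry `y ↦ e_0 + ∑_{i<n} ⟪e_i, y⟫ e_{i+1} - ⟪e_n, y⟫ e_0`, `n = N - 1`, whose orthonormal
vectors are chosen one at a time, orthogonal to all earlier iterates
(`DetAlgorithm.exists_orthonormalBelow`). The residual at the output, tested against `∑ e_i`,
telescopes to a value of size at least `1`; for this the last vector `e_n` only needs a coefficient
of the right sign at the output, so `2 (N - 1)` dimensions are enough.
-/

/-! ### Path sums and the Krylov rows of the step-size matrix -/

theorem mem_chains_succ {k m : ℕ} {c : Fin (m + 1) → ℕ × ℕ} :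
    c ∈ chains k (m + 1) ↔ (1 ≤ (c 0).2 ∧ (c 0).2 ≤ (c 0).1 ∧ (c 0).1 ≤ k) ∧
      Fin.tail c ∈ chains k m ∧ ∀ r : Fin m, (r : ℕ) = 0 → (c 0).1 < (Fin.tail c r).2 := by
  simp only [chains, Finset.mem_filter, Fintype.mem_piFinset, Finset.mem_product, Finset.mem_Icc,
    Fin.tail]
  constructor
  · rintro ⟨h1, h2, h3⟩
    refine ⟨⟨(h1 0).2.1, h2 0, (h1 0).1.2⟩, ⟨fun r => h1 r.succ, fun r => h2 r.succ, ?_⟩, ?_⟩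
    · intro r s hrs
      exact h3 r.succ s.succ (by simpa using hrs)
    · intro r hr
      exact h3 0 r.succ (by simp [hr])
  · rintro ⟨⟨h1, h2, h3⟩, ⟨h4, h5, h6⟩, h7⟩
    refine ⟨?_, ?_, ?_⟩
    · intro r
      refine Fin.cases ?_ (fun r => h4 r) r
      exact ⟨⟨h1.trans h2, h3⟩, h1, h2.trans h3⟩
    · intro r
      exact Fin.cases h2 (fun r => h5 r) r
    · intro r s
      refine Fin.cases ?_ (fun s => ?_) s
      · simp
      · refine Fin.cases ?_ (fun r => ?_) r
        · intro hs
          exact h7 s (by simpa using hs.symm)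
        · intro hs
          exact h6 r s (by simpa using hs)

namespace HMatrix

variable {N : ℕ} (H : HMatrix N)

/-- The part of `P(k, m; H)` whose first column index exceeds `i`. -/
def tailP (k m i : ℕ) : ℝ :=
  ∑ c ∈ chains k m with ∀ r : Fin m, (r : ℕ) = 0 → i < (c r).2, ∏ r, H.entry (c r).1 (c r).2

theorem Q_succ {k m j : ℕ} (hj : 1 ≤ j) :
    H.Q k (m + 1) j = ∑ i ∈ Finset.Icc j k, H.entry i j * H.tailP k m i := by
  simp only [Q, tailP, Finset.mul_sum]
  rw [Finset.sum_sigma']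
  refine Finset.sum_bij' (fun c _ => ⟨(c 0).1, Fin.tail c⟩) (fun x _ => Fin.cons (x.1, j) x.2)
    ?_ ?_ ?_ ?_ ?_
  · intro c hc
    simp only [Finset.mem_filter, mem_chains_succ] at hc
    obtain ⟨⟨⟨h1, h2, h3⟩, h4, h5⟩, h6⟩ := hc
    have := h6 0 rfl
    simp only [Finset.mem_sigma, Finset.mem_Icc, Finset.mem_filter]
    exact ⟨⟨by omega, h3⟩, h4, h5⟩
  · rintro ⟨i, c⟩ hc
    simp only [Finset.mem_sigma, Finset.mem_Icc, Finset.mem_filter] at hc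
    simp only [Finset.mem_filter, mem_chains_succ, Fin.cons_zero, Fin.tail_cons]
    refine ⟨⟨⟨hj, hc.1.1, hc.1.2⟩, hc.2.1, hc.2.2⟩, ?_⟩
    intro r hr
    obtain rfl : r = 0 := Fin.ext hr
    simp
  · intro c hc
    simp only [Finset.mem_filter] at hc
    have : ((c 0).1, j) = c 0 := by rw [← hc.2 0 rfl]
    simp only [this]
    exact Fin.cons_self_tail c
  · rintro ⟨i, c⟩ hc
    simp
  · intro c hc
    simp only [Finset.mem_filter] at hc
    rw [Fin.prod_univ_succ, hc.2 0 rfl]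
    rfl

theorem tailP_zero (k i : ℕ) : H.tailP k 0 i = 1 := by
  have : (chains k 0).filter (fun c => ∀ r : Fin 0, (r : ℕ) = 0 → i < (c r).2) = Finset.univ := by
    ext c
    simp [chains]
  rw [tailP, this]
  simp

theorem tailP_succ (k m i : ℕ) :
    H.tailP k (m + 1) i = ∑ j ∈ Finset.Ioc i k, H.Q k (m + 1) j := by
  unfold tailP Q
  rw [← Finset.sum_fiberwise_of_maps_to (g := fun c => (c 0).2) (t := Finset.Ioc i k)]
  · refine Finset.sum_congr rfl fun j hj => Finset.sum_congr ?_ fun _ _ => rfl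
    ext c
    simp only [Finset.mem_filter, Finset.mem_Ioc] at hj ⊢
    constructor
    · rintro ⟨⟨h1, h2⟩, h3⟩
      refine ⟨h1, fun r hr => ?_⟩
      obtain rfl : r = 0 := Fin.ext hr
      exact h3
    · rintro ⟨h1, h2⟩
      refine ⟨⟨h1, fun r hr => ?_⟩, h2 0 rfl⟩
      rw [h2 r hr]
      exact hj.1
  · intro c hc
    simp only [Finset.mem_filter, mem_chains_succ] at hc
    simp only [Finset.mem_Ioc]
    exact ⟨hc.2 0 rfl, hc.1.1.2.1.trans hc.1.1.2.2⟩

theorem P_eq_tailP (k m : ℕ) : H.P k m = H.tailP k m 0 := by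
  unfold P tailP
  rw [Finset.filter_true_of_mem]
  intro c hc r _
  simp only [chains, Finset.mem_filter, Fintype.mem_piFinset, Finset.mem_product,
    Finset.mem_Icc] at hc
  exact (hc.1 r).2.1

/-- The partial column sum `a_{k,j} = h_{j,j} + ⋯ + h_{k-1,j}`, for which
`y_{k-1} = y_0 - ∑_{j<k} 2 a_{k,j} g_j`. -/
def colSum (k j : ℕ) : ℝ := ∑ i ∈ Finset.Ico j k, H.entry i j

theorem colSum_self (k : ℕ) : H.colSum k k = 0 := by simp [colSum]

/-- The row vectors `e_Nᵀ A^m`, where `A = (a_{k,j})` is the strictly lower triangular `N × N`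
matrix of partial column sums: `krylov m j` is the entry of `e_Nᵀ A^m` in column `j`. -/
def krylov : ℕ → ℕ → ℝ
  | 0, j => if j = N then 1 else 0
  | m + 1, j => ∑ k ∈ Finset.Ioc j N, H.colSum k j * krylov m k

theorem krylov_succ (m j : ℕ) :
    H.krylov (m + 1) j = ∑ k ∈ Finset.Ioc j N, H.colSum k j * H.krylov m k := rfl

theorem krylov_eq_zero {m j : ℕ} (h : N < m + j) : H.krylov m j = 0 := by
  induction m generalizing j with
  | zero => rw [krylov, if_neg (by omega)]
  | succ m ih =>
    rw [krylov_succ]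
    refine Finset.sum_eq_zero fun k hk => ?_
    rw [Finset.mem_Ioc] at hk
    rw [ih (by omega), mul_zero]

theorem Q_eq_krylov {m j : ℕ} (hj : 1 ≤ j) (hjN : j ≤ N - 1) :
    H.Q (N - 1) (m + 1) j = H.krylov (m + 1) j := by
  induction m generalizing j with
  | zero =>
    rw [Q_succ _ hj, krylov_succ]
    simp only [krylov, mul_ite, mul_one, mul_zero, Finset.sum_ite_eq', tailP_zero,
      Finset.mem_Ioc]
    rw [if_pos ⟨by omega, le_rfl⟩, colSum]
    refine Finset.sum_congr ?_ fun _ _ => rfl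
    ext i
    simp only [Finset.mem_Icc, Finset.mem_Ico]
    omega
  | succ m ih =>
    rw [Q_succ _ hj, krylov_succ]
    simp only [tailP_succ, colSum, Finset.mul_sum, Finset.sum_mul]
    rw [Finset.sum_comm' (t' := Finset.Ioc j (N - 1)) (s' := fun k => Finset.Ico j k)]
    · refine (Finset.sum_congr rfl fun k hk => ?_).trans
        (Finset.sum_subset (s₂ := Finset.Ioc j N) ?_ ?_)
      · refine Finset.sum_congr rfl fun i _ => ?_
        rw [Finset.mem_Ioc] at hk
        rw [ih (by omega) (by omega)]
      · exact Finset.Ioc_subset_Ioc_right (by omega)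
      · intro k hk hk'
        simp only [Finset.mem_Ioc] at hk hk'
        rw [krylov_eq_zero _ (by omega : N < m + 1 + k)]
        simp
    · intro i k
      simp only [Finset.mem_Icc, Finset.mem_Ioc, Finset.mem_Ico]
      omega

theorem P_eq_sum_krylov {m : ℕ} :
    H.P (N - 1) (m + 1) = ∑ j ∈ Finset.Ioc 0 N, H.krylov (m + 1) j := by
  rw [P_eq_tailP, tailP_succ]
  refine (Finset.sum_congr rfl fun j hj => ?_).trans
    (Finset.sum_subset (Finset.Ioc_subset_Ioc_right (Nat.sub_le N 1)) ?_)
  · rw [Finset.mem_Ioc] at hj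
    exact H.Q_eq_krylov (by omega) (by omega)
  · intro j hj hj'
    simp only [Finset.mem_Ioc] at hj hj'
    exact H.krylov_eq_zero (by omega)

end HMatrix

/-! ### Polynomials with descending degrees -/

noncomputable section

open Polynomial

/-- The inner product of the coefficient vectors of two polynomials of degree less than `n`. -/
def coeffDot (n : ℕ) : ℝ[X] →ₗ[ℝ] ℝ[X] →ₗ[ℝ] ℝ :=
  LinearMap.mk₂ ℝ (fun p q => ∑ i ∈ Finset.range n, p.coeff i * q.coeff i)
    (fun p₁ p₂ q => by simp only [coeff_add, add_mul, Finset.sum_add_distrib])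
    (fun c p q => by simp only [coeff_smul, smul_eq_mul, Finset.mul_sum, mul_assoc])
    (fun p q₁ q₂ => by simp only [coeff_add, mul_add, Finset.sum_add_distrib])
    (fun c p q => by
      simp only [coeff_smul, smul_eq_mul, Finset.mul_sum]
      exact Finset.sum_congr rfl fun i _ => by ring)

theorem coeffDot_apply (n : ℕ) (p q : ℝ[X]) :
    coeffDot n p q = ∑ i ∈ Finset.range n, p.coeff i * q.coeff i := rfl

theorem coeffDot_comm (n : ℕ) (p q : ℝ[X]) : coeffDot n p q = coeffDot n q p := by
  simp only [coeffDot_apply, mul_comm]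

theorem coeffDot_X_pow {n i : ℕ} (hi : i < n) (p : ℝ[X]) : coeffDot n p (X ^ i) = p.coeff i := by
  simp [coeffDot_apply, coeff_X_pow, hi]

/-- Multiplication by `X` is an isometry as long as the degree stays below `n`. -/
theorem coeffDot_X_mul {n : ℕ} (p : ℝ[X]) {q : ℝ[X]} (hq : q.coeff n = 0) :
    coeffDot (n + 1) (X * p) (X * q) = coeffDot (n + 1) p q := by
  simp only [coeffDot_apply]
  rw [Finset.sum_range_succ', Finset.sum_range_succ]
  simp [hq]

/-- The polynomials `r 1, …, r N` have the exact degrees `N - 1, …, 0`. -/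
def IsStaircase (N : ℕ) (r : ℕ → ℝ[X]) : Prop :=
  ∀ k ∈ Finset.Ioc 0 N, (∀ i, N - k < i → (r k).coeff i = 0) ∧ (r k).coeff (N - k) ≠ 0

namespace IsStaircase

variable {N : ℕ} {r : ℕ → ℝ[X]}

theorem exists_eq_sum (hr : IsStaircase N r) {j : ℕ} (hj : j ≤ N) {f : ℝ[X]}
    (hf : ∀ i, N - j ≤ i → f.coeff i = 0) :
    ∃ c : ℕ → ℝ, f = ∑ k ∈ Finset.Ioc j N, c k • r k := by
  induction hj using Nat.decreasingInduction generalizing f with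
  | self =>
    refine ⟨0, ?_⟩
    ext i
    simpa using hf i (by omega)
  | of_succ j hj ih =>
    obtain ⟨h1, h2⟩ := hr (j + 1) (Finset.mem_Ioc.2 ⟨by omega, hj⟩)
    set a := f.coeff (N - (j + 1)) / (r (j + 1)).coeff (N - (j + 1)) with ha
    obtain ⟨c, hc⟩ := ih (f := f - a • r (j + 1)) (by
      intro i hi
      rcases hi.eq_or_lt with rfl | hi
      · simp [ha, h2]
      · simp [hf i (by omega), h1 i hi])
    refine ⟨fun k => if k = j + 1 then a else c k, ?_⟩
    rw [← Finset.insert_Ioc_succ_left_eq_Ioc hj, Finset.sum_insert (by simp)]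
    rw [Order.succ_eq_add_one]
    beta_reduce
    rw [if_pos rfl, ← sub_eq_iff_eq_add', hc]
    refine Finset.sum_congr rfl fun k hk => ?_
    rw [Finset.mem_Ioc] at hk
    rw [if_neg (by omega)]

theorem eq_zero_of_sum_eq_zero (hr : IsStaircase N r) {j : ℕ} {c : ℕ → ℝ}
    (h : ∑ k ∈ Finset.Ioc j N, c k • r k = 0) : ∀ k ∈ Finset.Ioc j N, c k = 0 := by
  intro k
  induction k using Nat.strong_induction_on with
  | _ k ih =>
    intro hk
    have h1 := congrArg (fun p => p.coeff (N - k)) h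
    simp only [finsetSum_coeff, coeff_smul, smul_eq_mul, coeff_zero] at h1
    rw [Finset.mem_Ioc] at hk
    rw [Finset.sum_eq_single k] at h1
    · exact (mul_eq_zero.1 h1).resolve_right (hr k (Finset.mem_Ioc.2 (by omega))).2
    · intro l hl hlk
      rcases hlk.lt_or_gt with hlt | hgt
      · rw [ih l hlt hl, zero_mul]
      · rw [Finset.mem_Ioc] at hl
        rw [(hr l (Finset.mem_Ioc.2 (by omega))).1 _ (by omega), mul_zero]
    · intro hk'
      exact absurd (Finset.mem_Ioc.2 hk) hk'

theorem eq_of_sum_eq (hr : IsStaircase N r) {j : ℕ} {c c' : ℕ → ℝ}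
    (h : ∑ k ∈ Finset.Ioc j N, c k • r k = ∑ k ∈ Finset.Ioc j N, c' k • r k) :
    ∀ k ∈ Finset.Ioc j N, c k = c' k := by
  intro k hk
  refine sub_eq_zero.1 (hr.eq_zero_of_sum_eq_zero (c := fun k => c k - c' k) ?_ k hk)
  simp only [sub_smul, Finset.sum_sub_distrib, h, sub_self]

end IsStaircase

/-- The polynomial `(1 + X + ⋯ + X^{n-1}) / n` (zero for `n = 0`). -/
def avgPoly (n : ℕ) : ℝ[X] := (n : ℝ)⁻¹ • ∑ i ∈ Finset.range n, X ^ i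

theorem avgPoly_coeff (n i : ℕ) : (avgPoly n).coeff i = if i < n then (n : ℝ)⁻¹ else 0 := by
  simp [avgPoly, coeff_X_pow]

theorem avgPoly_eval_one {n : ℕ} (hn : n ≠ 0) : (avgPoly n).eval 1 = 1 := by
  have : (n : ℝ) ≠ 0 := by exact_mod_cast hn
  simp [avgPoly, eval_finsetSum, this]

/-- In the variable `X + 1`, the polynomial `avgPoly n` has binomial coefficients. -/
theorem taylor_avgPoly_coeff (n m : ℕ) :
    (taylor 1 (avgPoly n)).coeff m = (n : ℝ)⁻¹ * (n.choose (m + 1) : ℝ) := by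
  have h1 : X * taylor 1 (avgPoly n) = (n : ℝ)⁻¹ • ((X + 1) ^ n - 1 : ℝ[X]) := by
    have := geom_sum_mul (X + 1 : ℝ[X]) n
    rw [add_sub_cancel_right] at this
    rw [← this]
    simp [avgPoly, taylor_apply, mul_comm]
  rw [← coeff_X_mul, h1]
  simp [coeff_X_add_one_pow, coeff_one]

theorem coeffDot_avgPoly {n : ℕ} {p : ℝ[X]} (hp : p.natDegree < n) :
    coeffDot n p (avgPoly n) = (n : ℝ)⁻¹ * p.eval 1 := by
  rw [eval_eq_sum_range' hp, coeffDot_apply, Finset.mul_sum]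
  refine Finset.sum_congr rfl fun i hi => ?_
  rw [avgPoly_coeff, if_pos (Finset.mem_range.1 hi)]
  ring

/-! ### Column polynomials of a step-size matrix -/

namespace HMatrix

variable {N : ℕ} (H : HMatrix N)

/-- The generating polynomial `∑ m, (e_Nᵀ A^m)_j (X - 1)^m` of column `j`. Expanding in powers of
`X - 1` turns the Gram matrix of the columns into the Euclidean one. -/
def colPoly (j : ℕ) : ℝ[X] := ∑ m ∈ Finset.range N, H.krylov m j • (X - C 1) ^ m

/-- The polynomial `∑_{k > j} a_{k,j} r_k`, where `r_k = colPoly k`; it is the quotient of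
`r_j - r_j(1)` by `X - 1`. -/
def colQuot (j : ℕ) : ℝ[X] := ∑ k ∈ Finset.Ioc j N, H.colSum k j • H.colPoly k

theorem taylor_colPoly_coeff {m j : ℕ} (hj : 1 ≤ j) :
    (taylor 1 (H.colPoly j)).coeff m = H.krylov m j := by
  have : taylor 1 (H.colPoly j) = ∑ m ∈ Finset.range N, H.krylov m j • X ^ m := by
    simp [colPoly, taylor_apply]
  rw [this]
  simp only [finsetSum_coeff, coeff_smul, coeff_X_pow, smul_eq_mul, mul_ite, mul_one, mul_zero,
    Finset.sum_ite_eq, Finset.mem_range]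
  split_ifs with h
  · rfl
  · rw [H.krylov_eq_zero (by omega)]

theorem colPoly_self (hN : 1 ≤ N) : H.colPoly N = 1 := by
  apply taylor_injective 1
  ext m
  rw [taylor_colPoly_coeff _ hN, taylor_one, coeff_C]
  rcases m with _ | m
  · simp [krylov]
  · rw [H.krylov_eq_zero (by omega)]
    simp

theorem colPoly_eq_mul_colQuot {j : ℕ} (hj : 1 ≤ j) (hjN : j < N) :
    H.colPoly j = (X - 1) * H.colQuot j := by
  apply taylor_injective 1
  ext m
  rw [taylor_colPoly_coeff _ hj, taylor_mul]
  have : taylor 1 (X - 1 : ℝ[X]) = X := by simp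
  rw [this, colQuot]
  rcases m with _ | m
  · rw [coeff_X_mul_zero, krylov, if_neg (by omega)]
  · rw [coeff_X_mul, krylov_succ, map_sum, finsetSum_coeff]
    refine Finset.sum_congr rfl fun k hk => ?_
    rw [Finset.mem_Ioc] at hk
    rw [LinearMap.map_smul, coeff_smul, taylor_colPoly_coeff _ (by omega), smul_eq_mul]

theorem colPoly_eval_one {j : ℕ} (hj : 1 ≤ j) (hjN : j ≤ N) :
    (H.colPoly j).eval 1 = if j = N then 1 else 0 := by
  split_ifs with h
  · subst h
    simp [colPoly_self _ hj]
  · rw [colPoly_eq_mul_colQuot _ hj (by omega)]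
    simp

theorem colPoly_coeff (i j : ℕ) : (H.colPoly j).coeff i =
    ∑ m ∈ Finset.range N, H.krylov m j * ((-1) ^ (m - i) * (m.choose i : ℝ)) := by
  have hc (m : ℕ) : ((X - C 1 : ℝ[X]) ^ m).coeff i = (-1) ^ (m - i) * (m.choose i : ℝ) := by
    rw [sub_eq_add_neg, ← C_neg, coeff_X_add_C_pow]
  simp only [colPoly, finsetSum_coeff, coeff_smul, hc, smul_eq_mul]

theorem colPoly_coeff_eq_zero {i j : ℕ} (h : N - j < i) : (H.colPoly j).coeff i = 0 := by
  rw [colPoly_coeff]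
  refine Finset.sum_eq_zero fun m _ => ?_
  rcases lt_or_ge m i with hm | hm
  · simp [Nat.choose_eq_zero_of_lt hm]
  · rw [H.krylov_eq_zero (by omega), zero_mul]

theorem colPoly_coeff_top {j : ℕ} (hj : 1 ≤ j) (hjN : j ≤ N) :
    (H.colPoly j).coeff (N - j) = H.krylov (N - j) j := by
  rw [colPoly_coeff, Finset.sum_eq_single (N - j)]
  · simp
  · intro m _ hm
    rcases hm.lt_or_gt with hm | hm
    · simp [Nat.choose_eq_zero_of_lt hm]
    · rw [H.krylov_eq_zero (by omega), zero_mul]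
  · intro h
    exact absurd (Finset.mem_range.2 (by omega)) h

theorem colPoly_natDegree_lt {j : ℕ} (hj : 1 ≤ j) (hjN : j ≤ N) :
    (H.colPoly j).natDegree < N := by
  have : (H.colPoly j).natDegree ≤ N - j :=
    natDegree_le_iff_coeff_eq_zero.2 fun i hi => H.colPoly_coeff_eq_zero hi
  omega

/-- H-invariance says that the column polynomials sum to `(1 + X + ⋯ + X^{N-1}) / N`. -/
theorem isInvariant_iff_sum_colPoly (hN : 1 ≤ N) :
    H.IsInvariant ↔ ∑ j ∈ Finset.Ioc 0 N, H.colPoly j = avgPoly N := by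
  have key : ∀ m, (taylor 1 (∑ j ∈ Finset.Ioc 0 N, H.colPoly j)).coeff m =
      ∑ j ∈ Finset.Ioc 0 N, H.krylov m j := by
    intro m
    rw [map_sum, finsetSum_coeff]
    refine Finset.sum_congr rfl fun j hj => ?_
    rw [Finset.mem_Ioc] at hj
    exact H.taylor_colPoly_coeff hj.1
  constructor
  · intro h
    apply taylor_injective 1
    ext m
    rw [key, taylor_avgPoly_coeff]
    rcases m with _ | m
    · have : (N : ℝ) ≠ 0 := by positivity
      simp [krylov, this, show N ≠ 0 by omega]
    · rcases lt_or_ge (m + 1) N with hm | hm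
      · rw [← P_eq_sum_krylov, h (m + 1) (by omega) (by omega), one_div]
      · rw [Nat.choose_eq_zero_of_lt (by omega), Finset.sum_eq_zero]
        · simp
        · intro j hj
          rw [Finset.mem_Ioc] at hj
          exact H.krylov_eq_zero (by omega)
  · intro h m hm hmN
    obtain ⟨m, rfl⟩ : ∃ m', m = m' + 1 := ⟨m - 1, by omega⟩
    rw [P_eq_sum_krylov, ← key, h, taylor_avgPoly_coeff, one_div]

end HMatrix

end

/-! ### H-certificates -/

noncomputable section

open Polynomial

/-- A sum over pairs `j < k` of a symmetric function vanishing on the diagonal is half of the sum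
over all pairs. -/
theorem two_mul_sum_lt_eq_sum_sum (n : ℕ) (f : ℕ → ℕ → ℝ) (hsymm : ∀ k j, f k j = f j k)
    (hdiag : ∀ k, f k k = 0) :
    2 * ∑ k ∈ Finset.Icc 1 n, ∑ j ∈ Finset.Icc 1 (k - 1), f k j =
      ∑ k ∈ Finset.Ioc 0 n, ∑ j ∈ Finset.Ioc 0 n, f k j := by
  induction n with
  | zero => simp
  | succ n ih =>
    have h1 : Finset.Icc 1 n = Finset.Ioc 0 n := rfl
    rw [Finset.sum_Icc_succ_top (by omega), mul_add, ih, Nat.add_sub_cancel, h1]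
    simp only [Finset.sum_Ioc_succ_top (Nat.zero_le n), Finset.sum_add_distrib, hdiag]
    rw [Finset.sum_congr rfl fun k _ => hsymm k (n + 1)]
    ring

namespace HMatrix

variable {N : ℕ} (H : HMatrix N)

/-- The product `A g` of the strictly lower triangular matrix `A = (a_{k,j})` with a vector. -/
def colSumMul (g : ℕ → ℝ) (k : ℕ) : ℝ := ∑ j ∈ Finset.Ico 1 k, H.colSum k j * g j

theorem formalY_eq {d : ℕ} (y₀ : EuclideanSpace ℝ (Fin d)) (g : ℕ → EuclideanSpace ℝ (Fin d))
    (k : ℕ) : H.formalY y₀ g k =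
      y₀ - ∑ j ∈ Finset.Ico 1 (k + 1), (2 * H.colSum (k + 1) j) • g j := by
  induction k with
  | zero => simp [formalY]
  | succ k ih =>
    have h1 : ∑ j ∈ Finset.range (k + 1), (2 * H.entry (k + 1) (j + 1)) • g (j + 1) =
        ∑ j ∈ Finset.Ico 1 (k + 2), (2 * H.entry (k + 1) j) • g j := by
      rw [Finset.sum_Ico_eq_sum_range]
      exact Finset.sum_congr rfl fun j _ => by rw [add_comm 1 j]
    have h2 : ∑ j ∈ Finset.Ico 1 (k + 1), (2 * H.colSum (k + 1) j) • g j =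
        ∑ j ∈ Finset.Ico 1 (k + 2), (2 * H.colSum (k + 1) j) • g j := by
      rw [Finset.sum_Ico_succ_top (b := k + 1) (by omega)]
      simp [colSum]
    rw [formalY, ih, h1, h2, sub_sub, ← Finset.sum_add_distrib]
    congr 1
    refine Finset.sum_congr rfl fun j hj => ?_
    rw [Finset.mem_Ico] at hj
    rw [← add_smul, ← mul_add, colSum, colSum, Finset.sum_Ico_succ_top (b := k + 1) (by omega)]

theorem formalX_apply {d : ℕ} (y₀ : EuclideanSpace ℝ (Fin d)) (g : ℕ → EuclideanSpace ℝ (Fin d))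
    {k : ℕ} (hk : 1 ≤ k) (i : Fin d) : H.formalX y₀ g k i =
      y₀ i - (g k i + 2 * H.colSumMul (fun j => g j i) k) := by
  obtain ⟨k, rfl⟩ : ∃ k', k = k' + 1 := ⟨k - 1, by omega⟩
  rw [formalX, Nat.add_sub_cancel, formalY_eq]
  simp only [colSumMul, PiLp.sub_apply, WithLp.ofLp_sum, Finset.sum_apply, PiLp.smul_apply,
    smul_eq_mul, Finset.mul_sum, mul_assoc]
  ring

/-- The certificate identity decouples over the coordinates of the vectors, so it is an identity
of quadratic forms in real variables; `y_0` cancels. -/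
theorem isCertificate_iff (hN : 1 ≤ N) (lam : ℕ → ℕ → ℝ) : H.IsCertificate lam ↔
    (∀ k j : ℕ, ¬ (1 ≤ j ∧ j < k ∧ k ≤ N) → lam k j = 0) ∧
    ∀ g : ℕ → ℝ, N * g N ^ 2 = g N * (g N + 2 * H.colSumMul g N) +
      ∑ k ∈ Finset.Icc 1 N, ∑ j ∈ Finset.Icc 1 (k - 1), lam k j *
        (((g k + 2 * H.colSumMul g k) - (g j + 2 * H.colSumMul g j)) * (g k - g j)) := by
  have key : ∀ (d : ℕ) (y₀ : EuclideanSpace ℝ (Fin d)) (g : ℕ → EuclideanSpace ℝ (Fin d)),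
      (N : ℝ) * ‖g N‖ ^ 2 + inner ℝ (g N) (H.formalX y₀ g N - y₀) +
        ∑ k ∈ Finset.Icc 1 N, ∑ j ∈ Finset.Icc 1 (k - 1),
          lam k j * inner ℝ (H.formalX y₀ g k - H.formalX y₀ g j) (g k - g j) =
      ∑ i : Fin d, (N * g N i ^ 2 - (g N i * (g N i + 2 * H.colSumMul (fun j => g j i) N) +
        ∑ k ∈ Finset.Icc 1 N, ∑ j ∈ Finset.Icc 1 (k - 1), lam k j *
          (((g k i + 2 * H.colSumMul (fun j => g j i) k) -
            (g j i + 2 * H.colSumMul (fun j => g j i) j)) * (g k i - g j i)))) := by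
    intro d y₀ g
    have h1 : ∑ k ∈ Finset.Icc 1 N, ∑ j ∈ Finset.Icc 1 (k - 1),
          lam k j * inner ℝ (H.formalX y₀ g k - H.formalX y₀ g j) (g k - g j) =
        ∑ i : Fin d, ∑ k ∈ Finset.Icc 1 N, ∑ j ∈ Finset.Icc 1 (k - 1), -(lam k j *
          (((g k i + 2 * H.colSumMul (fun j => g j i) k) -
            (g j i + 2 * H.colSumMul (fun j => g j i) j)) * (g k i - g j i))) := by
      rw [Finset.sum_comm]
      refine Finset.sum_congr rfl fun k hk => ?_
      rw [Finset.sum_comm]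
      refine Finset.sum_congr rfl fun j hj => ?_
      rw [Finset.mem_Icc] at hk hj
      rw [PiLp.inner_apply, Finset.mul_sum]
      refine Finset.sum_congr rfl fun i _ => ?_
      simp only [PiLp.sub_apply, H.formalX_apply y₀ g hk.1, H.formalX_apply y₀ g hj.1,
        RCLike.inner_apply, conj_trivial]
      ring
    rw [h1, EuclideanSpace.real_norm_sq_eq, PiLp.inner_apply, Finset.mul_sum,
      ← Finset.sum_add_distrib, ← Finset.sum_add_distrib]
    refine Finset.sum_congr rfl fun i _ => ?_
    simp only [PiLp.sub_apply, H.formalX_apply y₀ g hN, RCLike.inner_apply, conj_trivial,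
      Finset.sum_neg_distrib]
    ring
  refine and_congr_right fun _ => ⟨fun h g => ?_, fun h d y₀ g => ?_⟩
  · have := h 1 0 (fun k => EuclideanSpace.single 0 (g k))
    rw [key 1 0 fun k => EuclideanSpace.single 0 (g k)] at this
    simp only [Finset.univ_unique, Fin.default_eq_zero, Finset.sum_singleton,
      PiLp.single_apply, if_true] at this
    exact sub_eq_zero.1 this.symm
  · rw [key]
    refine (Finset.sum_eq_zero fun i _ => ?_).symm
    exact sub_eq_zero.2 (h fun j => g j i)

/-- The multipliers `λ_{k,j} = -N ⟨r_k, r_j⟩`, the off-diagonal entries of the solution of the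
Lyapunov equation `Lᵀ M + M L = 2 N e_N e_Nᵀ` with `L = 1 + 2 A`. -/
def gramCert (k j : ℕ) : ℝ :=
  if 1 ≤ j ∧ j < k ∧ k ≤ N then -(N * coeffDot N (H.colPoly k) (H.colPoly j)) else 0

theorem colQuot_coeff_eq_zero {j : ℕ} (hj : 1 ≤ j) {i : ℕ} (hi : N - 1 ≤ i) :
    (H.colQuot j).coeff i = 0 := by
  simp only [colQuot, finsetSum_coeff, coeff_smul, smul_eq_mul]
  refine Finset.sum_eq_zero fun k hk => ?_
  rw [Finset.mem_Ioc] at hk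
  rw [H.colPoly_coeff_eq_zero (by omega), mul_zero]

theorem colQuot_self : H.colQuot N = 0 := by simp [colQuot]

theorem sum_colPoly_eq (hN : 1 ≤ N) (g : ℕ → ℝ) :
    ∑ j ∈ Finset.Ioc 0 N, g j • H.colPoly j =
      (X - 1) * ∑ j ∈ Finset.Ioc 0 N, g j • H.colQuot j + C (g N) := by
  obtain ⟨n, rfl⟩ : ∃ n, N = n + 1 := ⟨N - 1, by omega⟩
  rw [Finset.sum_Ioc_succ_top (by omega), Finset.sum_Ioc_succ_top (by omega), colQuot_self,
    colPoly_self _ hN, smul_zero, add_zero, Finset.mul_sum, smul_eq_C_mul, mul_one]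
  congr 1
  refine Finset.sum_congr rfl fun j hj => ?_
  rw [Finset.mem_Ioc] at hj
  rw [H.colPoly_eq_mul_colQuot (by omega) (by omega), mul_smul_comm]

theorem sum_colSumMul_smul_colPoly (g : ℕ → ℝ) :
    ∑ k ∈ Finset.Ioc 0 N, H.colSumMul g k • H.colPoly k =
      ∑ j ∈ Finset.Ioc 0 N, g j • H.colQuot j := by
  simp only [colSumMul, colQuot, Finset.sum_smul, Finset.smul_sum, smul_smul]
  rw [Finset.sum_comm' (t' := Finset.Ioc 0 N) (s' := fun j => Finset.Ioc j N)]
  · simp only [mul_comm]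
  · intro k j
    simp only [Finset.mem_Ioc, Finset.mem_Ico]
    omega

/-- The Lyapunov equation for the Gram matrix of the column polynomials, as an identity of
quadratic forms: with `W = ∑ g_j w_j` both arguments are `(X ± 1) W + g_N`. -/
theorem coeffDot_sum_sum (hN : 1 ≤ N) (g : ℕ → ℝ) :
    coeffDot N (∑ k ∈ Finset.Ioc 0 N, (g k + 2 * H.colSumMul g k) • H.colPoly k)
      (∑ j ∈ Finset.Ioc 0 N, g j • H.colPoly j) = g N ^ 2 := by
  obtain ⟨n, rfl⟩ : ∃ n, N = n + 1 := ⟨N - 1, by omega⟩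
  set W := ∑ j ∈ Finset.Ioc 0 (n + 1), g j • H.colQuot j with hW
  have hWn : W.coeff n = 0 := by
    simp only [hW, finsetSum_coeff, coeff_smul, smul_eq_mul]
    refine Finset.sum_eq_zero fun k hk => ?_
    rw [Finset.mem_Ioc] at hk
    rw [H.colQuot_coeff_eq_zero hk.1 (by omega), mul_zero]
  have hC : C (g (n + 1)) = g (n + 1) • (1 : ℝ[X]) := by rw [smul_eq_C_mul, mul_one]
  have h1 : ∑ k ∈ Finset.Ioc 0 (n + 1), (g k + 2 * H.colSumMul g k) • H.colPoly k =
      X * W + W + g (n + 1) • 1 := by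
    simp only [add_smul, Finset.sum_add_distrib, mul_smul, ← Finset.smul_sum]
    rw [sum_colPoly_eq _ hN, sum_colSumMul_smul_colPoly, ← hW, hC, two_smul]
    ring
  have h2 : ∑ j ∈ Finset.Ioc 0 (n + 1), g j • H.colPoly j = X * W - W + g (n + 1) • 1 := by
    rw [sum_colPoly_eq _ hN, ← hW, hC]
    ring
  have hone (p : ℝ[X]) : coeffDot (n + 1) p 1 = p.coeff 0 := by
    rw [← coeffDot_X_pow (Nat.succ_pos n), pow_zero]
  rw [h1, h2]
  simp only [map_add, map_sub, LinearMap.add_apply, LinearMap.map_smul, LinearMap.smul_apply,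
    hone, coeffDot_comm _ 1, coeffDot_X_mul W hWn, coeffDot_comm _ W (X * W), coeff_X_mul_zero,
    smul_eq_mul, coeff_one_zero]
  ring

theorem gramCert_isCertificate (hN : 1 ≤ N) (hH : H.IsInvariant) :
    H.IsCertificate H.gramCert := by
  rw [isCertificate_iff _ hN]
  refine ⟨fun k j h => if_neg h, fun g => ?_⟩
  set x := fun k => g k + 2 * H.colSumMul g k with hx
  have hsum := (H.isInvariant_iff_sum_colPoly hN).1 hH
  have hN0 : (N : ℝ) ≠ 0 := by positivity
  -- the row sums of the Gram matrix are those of `e_N e_Nᵀ / N`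
  have hrow : ∀ k ∈ Finset.Ioc 0 N, ∑ j ∈ Finset.Ioc 0 N,
      coeffDot N (H.colPoly k) (H.colPoly j) = if k = N then (N : ℝ)⁻¹ else 0 := by
    intro k hk
    rw [Finset.mem_Ioc] at hk
    rw [← map_sum, hsum, coeffDot_avgPoly (H.colPoly_natDegree_lt hk.1 hk.2),
      H.colPoly_eval_one hk.1 hk.2]
    simp
  have h1 : 2 * ∑ k ∈ Finset.Icc 1 N, ∑ j ∈ Finset.Icc 1 (k - 1),
      H.gramCert k j * ((x k - x j) * (g k - g j)) =
      ∑ k ∈ Finset.Ioc 0 N, ∑ j ∈ Finset.Ioc 0 N,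
        -(N * coeffDot N (H.colPoly k) (H.colPoly j)) * ((x k - x j) * (g k - g j)) := by
    rw [← two_mul_sum_lt_eq_sum_sum]
    · congr 1
      refine Finset.sum_congr rfl fun k hk => Finset.sum_congr rfl fun j hj => ?_
      rw [Finset.mem_Icc] at hk hj
      rw [gramCert, if_pos (by omega)]
    · intro k j
      rw [coeffDot_comm]
      ring
    · simp
  have h2 : ∀ u v : ℕ → ℝ, ∑ k ∈ Finset.Ioc 0 N, ∑ j ∈ Finset.Ioc 0 N,
      coeffDot N (H.colPoly k) (H.colPoly j) * (u k * v j) =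
      coeffDot N (∑ k ∈ Finset.Ioc 0 N, u k • H.colPoly k)
        (∑ j ∈ Finset.Ioc 0 N, v j • H.colPoly j) := by
    intro u v
    simp only [map_sum, LinearMap.sum_apply, LinearMap.map_smul, LinearMap.smul_apply,
      smul_eq_mul]
    rw [Finset.sum_comm]
    exact Finset.sum_congr rfl fun k _ => Finset.sum_congr rfl fun j _ => by ring
  have h3 : ∑ k ∈ Finset.Ioc 0 N, ∑ j ∈ Finset.Ioc 0 N,
      coeffDot N (H.colPoly k) (H.colPoly j) * (x k * g k) = (N : ℝ)⁻¹ * (x N * g N) := by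
    simp only [← Finset.sum_mul]
    rw [Finset.sum_congr rfl fun k hk => by rw [hrow k hk]]
    simp [Nat.pos_of_ne_zero (by omega : N ≠ 0)]
  have h4 : ∑ k ∈ Finset.Ioc 0 N, ∑ j ∈ Finset.Ioc 0 N,
      coeffDot N (H.colPoly k) (H.colPoly j) * (x j * g j) = (N : ℝ)⁻¹ * (x N * g N) := by
    rw [Finset.sum_comm, ← h3]
    simp only [coeffDot_comm]
  have h5 := H.coeffDot_sum_sum hN g
  have h6 : ∑ k ∈ Finset.Ioc 0 N, ∑ j ∈ Finset.Ioc 0 N,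
        -(N * coeffDot N (H.colPoly k) (H.colPoly j)) * ((x k - x j) * (g k - g j)) =
      -N * ((N : ℝ)⁻¹ * (x N * g N) + (N : ℝ)⁻¹ * (x N * g N) - g N ^ 2 - g N ^ 2) := by
    have hsplit : ∑ k ∈ Finset.Ioc 0 N, ∑ j ∈ Finset.Ioc 0 N,
        -(N * coeffDot N (H.colPoly k) (H.colPoly j)) * ((x k - x j) * (g k - g j)) =
      -N * (∑ k ∈ Finset.Ioc 0 N, ∑ j ∈ Finset.Ioc 0 N,
          coeffDot N (H.colPoly k) (H.colPoly j) * (x k * g k) +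
        ∑ k ∈ Finset.Ioc 0 N, ∑ j ∈ Finset.Ioc 0 N,
          coeffDot N (H.colPoly k) (H.colPoly j) * (x j * g j) -
        ∑ k ∈ Finset.Ioc 0 N, ∑ j ∈ Finset.Ioc 0 N,
          coeffDot N (H.colPoly k) (H.colPoly j) * (x k * g j) -
        ∑ k ∈ Finset.Ioc 0 N, ∑ j ∈ Finset.Ioc 0 N,
          coeffDot N (H.colPoly k) (H.colPoly j) * (g k * x j)) := by
      simp only [← Finset.sum_add_distrib, ← Finset.sum_sub_distrib, Finset.mul_sum]
      exact Finset.sum_congr rfl fun k _ => Finset.sum_congr rfl fun j _ => by ring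
    rw [hsplit, h3, h4, h2 x g, h2 g x, coeffDot_comm _ (∑ k ∈ Finset.Ioc 0 N, g k • _), h5]
  have h7 : (N : ℝ) * ((N : ℝ)⁻¹ * (x N * g N)) = x N * g N := mul_inv_cancel_left₀ hN0 _
  linarith

theorem colSumMul_add (g h : ℕ → ℝ) (k : ℕ) :
    H.colSumMul (g + h) k = H.colSumMul g k + H.colSumMul h k := by
  simp only [colSumMul, Pi.add_apply, mul_add, Finset.sum_add_distrib]

/-- The difference of two certificates is a form `β` with `β(A g, h) + β(g, A h) = -β(g, h)`;
it vanishes because `A` is nilpotent. -/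
theorem isCertificate_unique (hN : 1 ≤ N) {lam lam' : ℕ → ℕ → ℝ} (h : H.IsCertificate lam)
    (h' : H.IsCertificate lam') : lam = lam' := by
  rw [isCertificate_iff _ hN] at h h'
  set β : (ℕ → ℝ) → (ℕ → ℝ) → ℝ := fun g h => ∑ k ∈ Finset.Icc 1 N, ∑ j ∈ Finset.Icc 1 (k - 1),
    (lam k j - lam' k j) * ((g k - g j) * (h k - h j)) with hβ
  have hquad (g : ℕ → ℝ) : β (fun k => g k + 2 * H.colSumMul g k) g = 0 := by
    simp only [hβ, sub_mul, Finset.sum_sub_distrib] at h h' ⊢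
    linarith [h.2 g, h'.2 g]
  have hpolar (g h : ℕ → ℝ) : β g h = -β (H.colSumMul g) h - β g (H.colSumMul h) := by
    have h1 : 2 * (β g h + β (H.colSumMul g) h + β g (H.colSumMul h)) =
        β (fun k => (g + h) k + 2 * H.colSumMul (g + h) k) (g + h) -
        β (fun k => g k + 2 * H.colSumMul g k) g - β (fun k => h k + 2 * H.colSumMul h k) h := by
      simp only [hβ, ← Finset.sum_add_distrib, ← Finset.sum_sub_distrib, Finset.mul_sum]
      refine Finset.sum_congr rfl fun k _ => Finset.sum_congr rfl fun j _ => ?_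
      simp only [colSumMul_add, Pi.add_apply]
      ring
    rw [hquad, hquad, hquad] at h1
    linarith
  have hshift {g : ℕ → ℝ} {p : ℕ} (hg : ∀ k ≤ p, g k = 0) : ∀ k ≤ p + 1, H.colSumMul g k = 0 := by
    intro k hk
    refine Finset.sum_eq_zero fun j hj => ?_
    rw [Finset.mem_Ico] at hj
    rw [hg j (by omega), mul_zero]
  have hvanish (n : ℕ) : ∀ (p q : ℕ) (g h : ℕ → ℝ), 2 * N ≤ p + q + n → (∀ k ≤ p, g k = 0) →
      (∀ k ≤ q, h k = 0) → β g h = 0 := by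
    induction n with
    | zero =>
      intro p q g h hpq hg hh
      refine Finset.sum_eq_zero fun k hk => Finset.sum_eq_zero fun j hj => ?_
      rw [Finset.mem_Icc] at hk hj
      rcases le_or_gt N p with hp | hp
      · rw [hg k (by omega), hg j (by omega)]
        ring
      · rw [hh k (by omega), hh j (by omega)]
        ring
    | succ n ih =>
      intro p q g h hpq hg hh
      rw [hpolar, ih (p + 1) q _ h (by omega) (hshift hg) hh,
        ih p (q + 1) g _ (by omega) hg (hshift hh)]
      simp
  ext k j
  by_cases hkj : 1 ≤ j ∧ j < k ∧ k ≤ N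
  · have h0 := hvanish (2 * N) 0 0 (Pi.single k 1) (Pi.single j 1) (by omega)
      (fun i hi => Pi.single_eq_of_ne (by omega) _) (fun i hi => Pi.single_eq_of_ne (by omega) _)
    simp only [hβ] at h0
    rw [Finset.sum_eq_single k, Finset.sum_eq_single j] at h0
    · rw [Pi.single_eq_same, Pi.single_eq_same, Pi.single_eq_of_ne (by omega),
        Pi.single_eq_of_ne (by omega)] at h0
      linarith
    · intro i hi hij
      rw [Finset.mem_Icc] at hi
      rw [Pi.single_eq_of_ne hij, Pi.single_eq_of_ne (by omega : k ≠ j)]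
      ring
    · intro hj
      exact absurd (Finset.mem_Icc.2 (by omega)) hj
    · intro l hl hlk
      refine Finset.sum_eq_zero fun i hi => ?_
      rw [Finset.mem_Icc] at hi hl
      rw [Pi.single_eq_of_ne hlk]
      rcases eq_or_ne i k with rfl | hik
      · rw [Pi.single_eq_of_ne (by omega : l ≠ j), Pi.single_eq_of_ne (by omega : i ≠ j)]
        ring
      · rw [Pi.single_eq_of_ne hik]
        ring
    · intro hk
      exact absurd (Finset.mem_Icc.2 (by omega)) hk
  · rw [h.1 k j hkj, h'.1 k j hkj]

theorem existsUnique_isCertificate (hN : 1 ≤ N) (hH : H.IsInvariant) :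
    ∃! lam, H.IsCertificate lam :=
  ⟨H.gramCert, H.gramCert_isCertificate hN hH, fun _ h =>
    H.isCertificate_unique hN h (H.gramCert_isCertificate hN hH)⟩

theorem certificate_eq_gramCert (hN : 1 ≤ N) (hH : H.IsInvariant) :
    H.certificate = H.gramCert := by
  have hu := H.existsUnique_isCertificate hN hH
  rw [certificate, dif_pos hu]
  exact H.isCertificate_unique hN hu.exists.choose_spec (H.gramCert_isCertificate hN hH)

end HMatrix

end

/-! ### The prescribed column polynomials -/

noncomputable section

open Polynomial

/-- The difference of two consecutive averages `(1 + ⋯ + X^{n-1}) / n`. -/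
def avgDiff (n : ℕ) : ℝ[X] := avgPoly (n + 1) - avgPoly n

theorem avgDiff_coeff_lt {n i : ℕ} (hi : i < n) :
    (avgDiff n).coeff i = -((n : ℝ) * (n + 1))⁻¹ := by
  have : (n : ℝ) ≠ 0 := by exact_mod_cast (by omega : n ≠ 0)
  rw [avgDiff, coeff_sub, avgPoly_coeff, avgPoly_coeff, if_pos (by omega), if_pos hi]
  push_cast
  field_simp
  ring

theorem avgDiff_coeff_self (n : ℕ) : (avgDiff n).coeff n = ((n : ℝ) + 1)⁻¹ := by
  rw [avgDiff, coeff_sub, avgPoly_coeff, avgPoly_coeff, if_pos (by omega), if_neg (by omega)]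
  push_cast
  ring

theorem avgDiff_coeff_gt {n i : ℕ} (hi : n < i) : (avgDiff n).coeff i = 0 := by
  rw [avgDiff, coeff_sub, avgPoly_coeff, avgPoly_coeff, if_neg (by omega), if_neg (by omega),
    sub_zero]

theorem avgDiff_zero : avgDiff 0 = 1 := by simp [avgDiff, avgPoly]

theorem avgDiff_eval_one {n : ℕ} (hn : n ≠ 0) : (avgDiff n).eval 1 = 0 := by
  rw [avgDiff, eval_sub, avgPoly_eval_one (by omega), avgPoly_eval_one hn, sub_self]

theorem taylor_avgDiff_coeff (n m : ℕ) : (taylor 1 (avgDiff (n + 1))).coeff (m + 1) =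
    1 / ((m : ℝ) + 2) * (n.choose m : ℝ) := by
  have h1 : ((n + 1).choose (m + 1) : ℝ) = n.choose m + n.choose (m + 1) := by
    exact_mod_cast Nat.choose_succ_succ n m
  have h2 : ((n : ℝ) + 2) * (n + 1).choose (m + 1) = (n + 2).choose (m + 2) * (m + 2) := by
    exact_mod_cast Nat.add_one_mul_choose_eq (n + 1) (m + 1)
  have h3 : ((n : ℝ) + 1) * n.choose (m + 1) = (n + 1).choose (m + 2) * (m + 2) := by
    exact_mod_cast Nat.add_one_mul_choose_eq n (m + 1)
  have h2' : ((n + 2).choose (m + 2) : ℝ) =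
      ((n : ℝ) + 2) * (n + 1).choose (m + 1) / (m + 2) := by
    rw [h2]
    field_simp
  have h3' : ((n + 1).choose (m + 2) : ℝ) = ((n : ℝ) + 1) * n.choose (m + 1) / (m + 2) := by
    rw [h3]
    field_simp
  rw [avgDiff, map_sub, coeff_sub, taylor_avgPoly_coeff, taylor_avgPoly_coeff]
  rw [show n + 1 + 1 = n + 2 from rfl, show m + 1 + 1 = m + 2 from rfl, h2', h3', h1]
  push_cast
  field_simp
  ring

/-- A polynomial of degree at most `n` that vanishes at `1` and is orthogonal to the polynomials
of degree less than `n` that vanish at `1` is a multiple of `avgDiff n`. -/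
theorem exists_eq_smul_avgDiff {n : ℕ} (hn : n ≠ 0) {p : ℝ[X]} (hdeg : ∀ i, n < i → p.coeff i = 0)
    (hone : p.eval 1 = 0) (hconst : ∀ i, i + 1 < n → p.coeff (i + 1) = p.coeff i) :
    ∃ γ : ℝ, p = γ • avgDiff n := by
  have hn0 : (n : ℝ) ≠ 0 := by exact_mod_cast hn
  have hc (i : ℕ) (hi : i < n) : p.coeff i = p.coeff 0 := by
    induction i with
    | zero => rfl
    | succ i ih => rw [hconst i hi, ih (by omega)]
  have htop : p.coeff n = -(n * p.coeff 0) := by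
    have hnat : p.natDegree < n + 1 :=
      Nat.lt_succ_of_le (natDegree_le_iff_coeff_eq_zero.2 fun i hi => hdeg i hi)
    rw [eval_eq_sum_range' hnat, Finset.sum_range_succ,
      Finset.sum_congr rfl fun i hi => by rw [hc i (Finset.mem_range.1 hi)]] at hone
    simp at hone
    linarith
  refine ⟨-(n * (n + 1) * p.coeff 0), ?_⟩
  ext i
  rw [coeff_smul, smul_eq_mul]
  rcases lt_trichotomy i n with hi | rfl | hi
  · rw [avgDiff_coeff_lt hi, hc i hi]
    field_simp
  · rw [avgDiff_coeff_self, htop]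
    field_simp
  · rw [avgDiff_coeff_gt hi, hdeg i hi, mul_zero]

/-- A polynomial of the form `a X^{n+1} + b X^n` vanishing at `1`. -/
theorem exists_eq_smul_X_pow_sub {n : ℕ} {p : ℝ[X]} (hdeg : ∀ i, n + 1 < i → p.coeff i = 0)
    (hone : p.eval 1 = 0) (hlow : ∀ i, i < n → p.coeff i = 0) :
    ∃ γ : ℝ, p = γ • (X ^ (n + 1) - X ^ n) := by
  have htop : p.coeff n = -p.coeff (n + 1) := by
    have hnat : p.natDegree < n + 2 :=
      Nat.lt_succ_of_le (natDegree_le_iff_coeff_eq_zero.2 fun i hi => hdeg i hi)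
    rw [eval_eq_sum_range' hnat, Finset.sum_range_succ, Finset.sum_range_succ,
      Finset.sum_eq_zero fun i hi => by rw [hlow i (Finset.mem_range.1 hi), zero_mul]] at hone
    simp at hone
    linarith
  refine ⟨p.coeff (n + 1), ?_⟩
  ext i
  rw [coeff_smul, smul_eq_mul, coeff_sub, coeff_X_pow, coeff_X_pow]
  rcases lt_or_ge i n with hi | hi
  · rw [hlow i hi, if_neg (by omega), if_neg (by omega)]
    ring
  rcases hi.eq_or_lt with rfl | hi
  · rw [htop, if_neg (by omega), if_pos rfl]
    ring
  rcases eq_or_lt_of_le (Nat.succ_le_of_lt hi) with rfl | hi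
  · simp
  · rw [hdeg i hi, if_neg (by omega), if_neg (by omega)]
    ring

/-- The column polynomials that correspond to the prescribed Q-functions, extended by `1` for the
column `N`. -/
def targetPoly (N N' j : ℕ) : ℝ[X] :=
  if j < N' then ((j : ℝ) / N) • (X ^ (N - j) - X ^ (N - j - 1))
  else if j = N' then (((N' : ℝ) * ((N : ℝ) - N' + 1)) / N) • avgDiff (N - j)
  else avgDiff (N - j)

section

variable {N N' : ℕ}

theorem targetPoly_of_lt {j : ℕ} (hj : j < N') :
    targetPoly N N' j = ((j : ℝ) / N) • (X ^ (N - j) - X ^ (N - j - 1)) := if_pos hj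

theorem exists_targetPoly_eq_smul (hN' : 2 ≤ N') (hN : N' + 2 ≤ N) {j : ℕ} (hj : N' ≤ j) :
    ∃ w : ℝ, 0 < w ∧ targetPoly N N' j = w • avgDiff (N - j) := by
  rw [targetPoly, if_neg (by omega)]
  split_ifs with h
  · refine ⟨_, ?_, rfl⟩
    have h1 : (N' : ℝ) + 2 ≤ N := by exact_mod_cast hN
    have h2 : (2 : ℝ) ≤ N' := by exact_mod_cast hN'
    exact div_pos (mul_pos (by linarith) (by linarith)) (by linarith)
  · exact ⟨1, one_pos, (one_smul _ _).symm⟩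

theorem targetPoly_self (hN : N' + 2 ≤ N) : targetPoly N N' N = 1 := by
  rw [targetPoly, if_neg (by omega), if_neg (by omega), Nat.sub_self, avgDiff_zero]

theorem targetPoly_eval_one (hN' : 2 ≤ N') (hN : N' + 2 ≤ N) {j : ℕ} (hj : j < N) :
    (targetPoly N N' j).eval 1 = 0 := by
  rcases lt_or_ge j N' with h | h
  · simp [targetPoly_of_lt h]
  · obtain ⟨w, -, hw⟩ := exists_targetPoly_eq_smul hN' hN h
    rw [hw, eval_smul, avgDiff_eval_one (by omega), smul_zero]

theorem targetPoly_coeff_gt (hN' : 2 ≤ N') (hN : N' + 2 ≤ N) {i j : ℕ}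
    (hi : N - j < i) : (targetPoly N N' j).coeff i = 0 := by
  rcases lt_or_ge j N' with h | h
  · rw [targetPoly_of_lt h, coeff_smul, coeff_sub, coeff_X_pow, coeff_X_pow, if_neg (by omega),
      if_neg (by omega), sub_self, smul_zero]
  · obtain ⟨w, -, hw⟩ := exists_targetPoly_eq_smul hN' hN h
    rw [hw, coeff_smul, avgDiff_coeff_gt hi, smul_zero]

theorem targetPoly_coeff_top_pos (hN' : 2 ≤ N') (hN : N' + 2 ≤ N) {j : ℕ} (hj : 1 ≤ j) :
    0 < (targetPoly N N' j).coeff (N - j) := by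
  rcases lt_or_ge j N' with h | h
  · rw [targetPoly_of_lt h, coeff_smul, coeff_sub, coeff_X_pow, coeff_X_pow, if_pos rfl,
      if_neg (by omega), sub_zero, smul_eq_mul, mul_one]
    have h1 : (0 : ℝ) < j := by exact_mod_cast hj
    have h2 : (0 : ℝ) < N := by exact_mod_cast (by omega : 0 < N)
    positivity
  · obtain ⟨w, hw0, hw⟩ := exists_targetPoly_eq_smul hN' hN h
    rw [hw, coeff_smul, avgDiff_coeff_self, smul_eq_mul]
    positivity

theorem isStaircase_targetPoly (hN' : 2 ≤ N') (hN : N' + 2 ≤ N) :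
    IsStaircase N (targetPoly N N') := fun _ hk =>
  ⟨fun _ hi => targetPoly_coeff_gt hN' hN hi,
    (targetPoly_coeff_top_pos hN' hN (Finset.mem_Ioc.1 hk).1).ne'⟩

theorem taylor_targetPoly_coeff (hN' : 2 ≤ N') (hN : N' + 2 ≤ N) {j : ℕ} (hjN : j < N) (m : ℕ) :
    (taylor 1 (targetPoly N N' j)).coeff (m + 1) = profileQ N N' (m + 1) j := by
  obtain ⟨n, hn⟩ : ∃ n, N - j = n + 1 := ⟨N - j - 1, by omega⟩
  rw [targetPoly, profileQ]
  split_ifs with h1 h2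
  · have : taylor 1 (((j : ℝ) / N) • (X ^ (N - j) - X ^ (N - j - 1)) : ℝ[X]) =
        ((j : ℝ) / N) • (X * (X + 1) ^ n) := by
      rw [hn, Nat.add_sub_cancel, LinearMap.map_smul, map_sub, taylor_pow, taylor_pow, taylor_X,
        C_1]
      congr 1
      ring
    rw [this, coeff_smul, coeff_X_mul, coeff_X_add_one_pow, smul_eq_mul, hn]
    simp
  · subst h2
    rw [LinearMap.map_smul, coeff_smul, hn, taylor_avgDiff_coeff, smul_eq_mul]
    simp only [Nat.add_sub_cancel]
    have hN0 : (N : ℝ) ≠ 0 := by exact_mod_cast (by omega : N ≠ 0)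
    push_cast
    rw [show (m : ℝ) + 1 + 1 = m + 2 by ring]
    field_simp
  · rw [hn, taylor_avgDiff_coeff]
    simp only [Nat.add_sub_cancel]
    push_cast
    ring

theorem profileQ_eq_zero {j m : ℕ} (hm : N - j ≤ m) (hjN : j < N) :
    profileQ N N' (m + 1) j = 0 := by
  have h (h : N - j - 1 < m) : (N - j - 1).choose m = 0 := Nat.choose_eq_zero_of_lt h
  rw [profileQ]
  split_ifs with h1 h2
  · simp [h (by omega)]
  · subst h2
    simp [h (by omega)]
  · simp [h (by omega)]

theorem sum_targetPoly_lt {M : ℕ} (hM : M + 1 ≤ N) :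
    ∑ j ∈ Finset.Ioc 0 M, ((j : ℝ) / N) • (X ^ (N - j) - X ^ (N - j - 1) : ℝ[X]) =
      (N : ℝ)⁻¹ • (∑ i ∈ Finset.range N, X ^ i - ∑ i ∈ Finset.range (N - M), X ^ i -
        (M : ℝ) • X ^ (N - M - 1)) := by
  induction M with
  | zero => simp
  | succ M ih =>
    obtain ⟨n, hn⟩ : ∃ n, N - M = n + 2 := ⟨N - M - 2, by omega⟩
    have hn' : N - (M + 1) = n + 1 := by omega
    rw [Finset.sum_Ioc_succ_top (by omega), ih (by omega), hn, hn', Finset.sum_range_succ _ (n + 1),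
      Nat.add_sub_cancel, show n + 2 - 1 = n + 1 from rfl]
    push_cast
    module

theorem sum_avgDiff {M : ℕ} (hM : M ≤ N) :
    ∑ j ∈ Finset.Ioc M N, avgDiff (N - j) = avgPoly (N - M) := by
  induction hM using Nat.decreasingInduction with
  | self => simp [avgPoly]
  | of_succ j hj ih =>
    rw [← Finset.insert_Ioc_succ_left_eq_Ioc hj, Finset.sum_insert (by simp)]
    rw [Order.succ_eq_add_one, ih, avgDiff, show N - (j + 1) + 1 = N - j by omega]
    abel

theorem sum_targetPoly (hN' : 2 ≤ N') (hN : N' + 2 ≤ N) :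
    ∑ j ∈ Finset.Ioc 0 N, targetPoly N N' j = avgPoly N := by
  obtain ⟨M, rfl⟩ : ∃ M, N' = M + 1 := ⟨N' - 1, by omega⟩
  obtain ⟨n, rfl⟩ : ∃ n, N = M + 1 + n := ⟨N - (M + 1), by omega⟩
  rw [← Finset.sum_Ioc_consecutive _ (Nat.zero_le (M + 1)) (by omega),
    Finset.sum_Ioc_succ_top (by omega)]
  have h1 : ∑ j ∈ Finset.Ioc 0 M, targetPoly (M + 1 + n) (M + 1) j = _ :=
    (Finset.sum_congr rfl fun j hj => targetPoly_of_lt (by rw [Finset.mem_Ioc] at hj; omega)).trans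
      (sum_targetPoly_lt (by omega))
  have h2 : ∑ j ∈ Finset.Ioc (M + 1) (M + 1 + n), targetPoly (M + 1 + n) (M + 1) j = _ :=
    (Finset.sum_congr rfl fun j hj => by
      rw [Finset.mem_Ioc] at hj
      rw [targetPoly, if_neg (by omega), if_neg (by omega)]).trans (sum_avgDiff (by omega))
  have hn : (n : ℝ) ≠ 0 := by exact_mod_cast (by omega : n ≠ 0)
  have hN0 : ((M : ℝ) + 1 + n) ≠ 0 := by positivity
  rw [h1, h2, targetPoly, if_neg (by omega), if_pos rfl, avgDiff, avgPoly, avgPoly, avgPoly,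
    show M + 1 + n - M = n + 1 by omega, show M + 1 + n - (M + 1) = n by omega,
    Nat.add_sub_cancel, Finset.sum_range_succ _ n]
  push_cast
  match_scalars
  · field_simp
  · field_simp
    ring
  · field_simp
    ring

end

end

/-! ### Sparsity patterns and the Q-function profile -/

noncomputable section

open Polynomial

namespace HMatrix

variable {N N' : ℕ} (H : HMatrix N)

/-- The prescribed Q-functions are the coefficients of `targetPoly` in powers of `X - 1`. -/
theorem hasProfile_iff (hN' : 2 ≤ N') (hN : N' + 2 ≤ N) :
    H.HasProfile N' ↔ ∀ j, 1 ≤ j → j ≤ N → H.colPoly j = targetPoly N N' j := by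
  constructor
  · intro h j hj hjN
    rcases hjN.eq_or_lt with rfl | hjN
    · rw [H.colPoly_self hj, targetPoly_self hN]
    · apply taylor_injective 1
      ext m
      rw [H.taylor_colPoly_coeff hj]
      rcases m with _ | m
      · rw [taylor_coeff_zero, targetPoly_eval_one hN' hN hjN, krylov, if_neg (by omega)]
      · rw [taylor_targetPoly_coeff hN' hN hjN]
        rcases lt_or_ge m (N - j) with hm | hm
        · rw [← H.Q_eq_krylov hj (by omega), h j (m + 1) hj (by omega) (by omega) (by omega)]
        · rw [profileQ_eq_zero hm hjN, H.krylov_eq_zero (by omega)]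
  · intro h j k hj hjN hk hkN
    obtain ⟨m, rfl⟩ : ∃ m, k = m + 1 := ⟨k - 1, by omega⟩
    rw [H.Q_eq_krylov hj hjN, ← H.taylor_colPoly_coeff hj, h j hj (by omega),
      taylor_targetPoly_coeff hN' hN (by omega)]

/-- The top coefficients are the products `h_{j,j} ⋯ h_{N-1,N-1}`, which are nonzero since
`P(N-1, N-1; H) = 1 / N`. -/
theorem isStaircase_colPoly (hN : 2 ≤ N) (hH : H.IsInvariant) : IsStaircase N H.colPoly := by
  have hstep (j : ℕ) (hj : j < N) : H.krylov (N - j) j =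
      H.colSum (j + 1) j * H.krylov (N - (j + 1)) (j + 1) := by
    rw [show N - j = N - (j + 1) + 1 by omega, krylov_succ, Finset.sum_eq_single (j + 1)]
    · intro k hk hkj
      rw [Finset.mem_Ioc] at hk
      rw [H.krylov_eq_zero (by omega), mul_zero]
    · intro h
      exact absurd (Finset.mem_Ioc.2 (by omega)) h
  have h1 : H.krylov (N - 1) 1 ≠ 0 := by
    have h2 := hH (N - 1) (by omega) le_rfl
    obtain ⟨n, rfl⟩ : ∃ n, N = n + 2 := ⟨N - 2, by omega⟩
    change H.P (n + 2 - 1) (n + 1) = _ at h2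
    rw [P_eq_sum_krylov, Finset.sum_eq_single 1] at h2
    · change H.krylov (n + 1) 1 ≠ 0
      rw [h2]
      simp
      positivity
    · intro k hk hkj
      rw [Finset.mem_Ioc] at hk
      exact H.krylov_eq_zero (by omega)
    · simp
  have h3 (j : ℕ) (hj : 1 ≤ j) (hjN : j ≤ N) : H.krylov (N - j) j ≠ 0 := by
    induction j, hj using Nat.le_induction with
    | base => exact h1
    | succ j hj ih =>
      have := ih (by omega)
      rw [hstep j (by omega)] at this
      exact right_ne_zero_of_mul this
  intro k hk
  rw [Finset.mem_Ioc] at hk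
  refine ⟨fun i hi => H.colPoly_coeff_eq_zero hi, ?_⟩
  rw [H.colPoly_coeff_top hk.1 hk.2]
  exact h3 k hk.1 hk.2

theorem coeffDot_eq_zero_of_gramCert {k j : ℕ} (hj : 1 ≤ j) (hjk : j < k) (hk : k ≤ N)
    (h : H.gramCert k j = 0) : coeffDot N (H.colPoly j) (H.colPoly k) = 0 := by
  rw [gramCert, if_pos ⟨hj, hjk, hk⟩, neg_eq_zero, coeffDot_comm] at h
  exact (mul_eq_zero.1 h).resolve_left (by exact_mod_cast (by omega : N ≠ 0))

/-- Top-sparsity makes column `j` orthogonal to all polynomials of degree at most `N - j - 2`. -/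
theorem exists_colPoly_eq_of_topSparse (hN : 2 ≤ N) (hH : H.IsInvariant) {j : ℕ} (hj : 1 ≤ j)
    (hjN : j < N) (hs : H.TopSparse j) :
    ∃ γ : ℝ, H.colPoly j = γ • (X ^ (N - j) - X ^ (N - j - 1)) := by
  have hr := H.isStaircase_colPoly hN hH
  rw [TopSparse, H.certificate_eq_gramCert (by omega) hH] at hs
  obtain ⟨n, hn⟩ : ∃ n, N - j = n + 1 := ⟨N - j - 1, by omega⟩
  rw [hn, Nat.add_sub_cancel]
  refine exists_eq_smul_X_pow_sub (fun i hi => H.colPoly_coeff_eq_zero (by omega)) ?_ ?_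
  · rw [H.colPoly_eval_one hj hjN.le, if_neg hjN.ne]
  · intro i hi
    obtain ⟨c, hc⟩ := hr.exists_eq_sum (j := j + 1) (f := X ^ i) (by omega) (by
      intro l hl
      rw [coeff_X_pow, if_neg (by omega)])
    rw [← coeffDot_X_pow (n := N) (by omega), hc, map_sum]
    refine Finset.sum_eq_zero fun k hk => ?_
    rw [Finset.mem_Ioc] at hk
    rw [LinearMap.map_smul, H.coeffDot_eq_zero_of_gramCert hj (by omega) hk.2
      (hs k (by omega) hk.2), smul_zero]

/-- Bottom-sparsity in the columns from `j` on makes column `j` orthogonal to all polynomials of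
degree less than `N - j` that vanish at `1`. -/
theorem exists_colPoly_eq_of_bottomSparse (hN : 2 ≤ N) (hH : H.IsInvariant) {j : ℕ} (hj : 1 ≤ j)
    (hjN : j < N) (hs : H.BottomSparse j) :
    ∃ γ : ℝ, H.colPoly j = γ • avgDiff (N - j) := by
  have hr := H.isStaircase_colPoly hN hH
  rw [BottomSparse, H.certificate_eq_gramCert (by omega) hH] at hs
  refine exists_eq_smul_avgDiff (by omega) (fun i hi => H.colPoly_coeff_eq_zero hi) ?_ ?_
  · rw [H.colPoly_eval_one hj hjN.le, if_neg hjN.ne]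
  · intro i hi
    obtain ⟨c, hc⟩ := hr.exists_eq_sum (j := j) (f := X ^ (i + 1) - X ^ i) (by omega) (by
      intro l hl
      rw [coeff_sub, coeff_X_pow, coeff_X_pow, if_neg (by omega), if_neg (by omega), sub_self])
    -- `X^{i+1} - X^i` vanishes at `1`, as do all `r_k` with `k < N`, so `r_N = 1` does not occur
    have hcN : c N = 0 := by
      have := congrArg (eval 1) hc
      rw [eval_finsetSum, Finset.sum_eq_single N] at this
      · simpa [H.colPoly_self (by omega : 1 ≤ N)] using this.symm
      · intro k hk hkN
        rw [Finset.mem_Ioc] at hk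
        rw [eval_smul, H.colPoly_eval_one (by omega) hk.2, if_neg hkN, smul_zero]
      · intro h
        exact absurd (Finset.mem_Ioc.2 (by omega)) h
    rw [← sub_eq_zero, ← coeffDot_X_pow (n := N) (i := i + 1) (by omega),
      ← coeffDot_X_pow (n := N) (i := i) (by omega), ← map_sub, hc, map_sum]
    refine Finset.sum_eq_zero fun k hk => ?_
    rw [Finset.mem_Ioc] at hk
    rw [LinearMap.map_smul]
    rcases hk.2.eq_or_lt with rfl | hkN
    · rw [hcN, zero_smul]
    · rw [H.coeffDot_eq_zero_of_gramCert hj hk.1 hk.2 (hs k (by omega) (by omega)), smul_zero]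

theorem hasProfile_of_sparse (hN' : 2 ≤ N') (hN : N' + 2 ≤ N) (hH : H.IsInvariant)
    (htop : ∀ j : ℕ, 1 ≤ j → j < N' → H.TopSparse j)
    (hbot : ∀ j : ℕ, N' ≤ j → j ≤ N - 1 → H.BottomSparse j) : H.HasProfile N' := by
  rw [H.hasProfile_iff hN' hN]
  have hγ (j : ℕ) : ∃ γ : ℝ, 1 ≤ j → j ≤ N → H.colPoly j = γ • targetPoly N N' j := by
    by_cases hj : 1 ≤ j ∧ j ≤ N
    swap
    · exact ⟨0, fun h1 h2 => absurd ⟨h1, h2⟩ hj⟩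
    obtain ⟨hj, hjN⟩ := hj
    rcases hjN.eq_or_lt with rfl | hjN
    · exact ⟨1, fun _ _ => by rw [H.colPoly_self hj, targetPoly_self hN, one_smul]⟩
    rcases lt_or_ge j N' with hjN' | hjN'
    · obtain ⟨γ, hγ⟩ := H.exists_colPoly_eq_of_topSparse (by omega) hH hj hjN (htop j hj hjN')
      have h1 : (j : ℝ) ≠ 0 := by exact_mod_cast (by omega : j ≠ 0)
      have h2 : (N : ℝ) ≠ 0 := by exact_mod_cast (by omega : N ≠ 0)
      refine ⟨γ / (j / N), fun _ _ => ?_⟩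
      rw [hγ, targetPoly_of_lt hjN', smul_smul, div_mul_cancel₀ _ (div_ne_zero h1 h2)]
    · obtain ⟨γ, hγ⟩ := H.exists_colPoly_eq_of_bottomSparse (by omega) hH hj hjN
        (hbot j hjN' (by omega))
      obtain ⟨w, hw0, hw⟩ := exists_targetPoly_eq_smul hN' hN hjN'
      refine ⟨γ / w, fun _ _ => ?_⟩
      rw [hγ, hw, smul_smul, div_mul_cancel₀ _ hw0.ne']
  choose γ hγ using hγ
  -- all scalars equal `1` since both families have the same sum
  have hsum : ∑ j ∈ Finset.Ioc 0 N, γ j • targetPoly N N' j =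
      ∑ j ∈ Finset.Ioc 0 N, (1 : ℝ) • targetPoly N N' j := by
    simp only [one_smul]
    rw [sum_targetPoly hN' hN, ← (H.isInvariant_iff_sum_colPoly (by omega)).1 hH]
    refine Finset.sum_congr rfl fun j hj => ?_
    rw [Finset.mem_Ioc] at hj
    exact (hγ j hj.1 hj.2).symm
  intro j hj hjN
  rw [hγ j hj hjN, (isStaircase_targetPoly hN' hN).eq_of_sum_eq hsum j (Finset.mem_Ioc.2 ⟨hj, hjN⟩),
    one_smul]

theorem isInvariant_of_hasProfile (hN' : 2 ≤ N') (hN : N' + 2 ≤ N) (hP : H.HasProfile N') :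
    H.IsInvariant := by
  rw [H.isInvariant_iff_sum_colPoly (by omega), ← sum_targetPoly hN' hN]
  refine Finset.sum_congr rfl fun j hj => ?_
  rw [Finset.mem_Ioc] at hj
  exact (H.hasProfile_iff hN' hN).1 hP j hj.1 hj.2

theorem certificate_eq_of_hasProfile (hN' : 2 ≤ N') (hN : N' + 2 ≤ N) (hP : H.HasProfile N')
    {k j : ℕ} (hj : 1 ≤ j) (hjk : j < k) (hk : k ≤ N) : H.certificate k j =
      -(N * coeffDot N (targetPoly N N' k) (targetPoly N N' j)) := by
  have h := (H.hasProfile_iff hN' hN).1 hP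
  rw [H.certificate_eq_gramCert (by omega) (H.isInvariant_of_hasProfile hN' hN hP), gramCert,
    if_pos ⟨hj, hjk, hk⟩, h k (by omega) hk, h j hj (by omega)]

theorem topSparse_of_hasProfile (hN' : 2 ≤ N') (hN : N' + 2 ≤ N) (hP : H.HasProfile N')
    {j : ℕ} (hj : 1 ≤ j) (hjN' : j < N') : H.TopSparse j := by
  intro k hjk hk
  rw [H.certificate_eq_of_hasProfile hN' hN hP hj (by omega) hk, coeffDot_apply,
    Finset.sum_eq_zero, mul_zero, neg_zero]
  intro i _
  rcases lt_or_ge (N - k) i with hi | hi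
  · rw [targetPoly_coeff_gt hN' hN hi, zero_mul]
  · rw [targetPoly_of_lt hjN', coeff_smul, coeff_sub, coeff_X_pow, coeff_X_pow,
      if_neg (by omega), if_neg (by omega), sub_self, smul_zero, mul_zero]

/-- The coefficients of column `j` below the top one are all equal, and `r_k(1) = 0` for the later
columns `k < N`. -/
theorem bottomSparse_of_hasProfile (hN' : 2 ≤ N') (hN : N' + 2 ≤ N) (hP : H.HasProfile N')
    {j : ℕ} (hj : N' ≤ j) : H.BottomSparse j := by
  intro k hjk hk
  obtain ⟨w, -, hw⟩ := exists_targetPoly_eq_smul hN' hN hj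
  have hdeg : (targetPoly N N' k).natDegree < N :=
    lt_of_le_of_lt (natDegree_le_iff_coeff_eq_zero.2 fun i hi => targetPoly_coeff_gt hN' hN hi)
      (by omega : N - k < N)
  have h1 := targetPoly_eval_one hN' hN (by omega : k < N)
  rw [eval_eq_sum_range' hdeg] at h1
  simp only [one_pow, mul_one] at h1
  rw [H.certificate_eq_of_hasProfile hN' hN hP (by omega) (by omega) (by omega), coeffDot_apply]
  have h2 : ∀ i ∈ Finset.range N, (targetPoly N N' k).coeff i * (targetPoly N N' j).coeff i =
      (targetPoly N N' k).coeff i * (w * -(((N - j : ℕ) : ℝ) * ((N - j : ℕ) + 1))⁻¹) := by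
    intro i _
    rcases lt_or_ge (N - k) i with hi | hi
    · rw [targetPoly_coeff_gt hN' hN hi, zero_mul, zero_mul]
    · rw [hw, coeff_smul, avgDiff_coeff_lt (by omega), smul_eq_mul]
  rw [Finset.sum_congr rfl h2, ← Finset.sum_mul, h1, zero_mul, mul_zero, neg_zero]

/-- The two polynomials share exactly one power of `X`, where their coefficients have opposite
signs. -/
theorem certificate_succ_pos (hN' : 2 ≤ N') (hN : N' + 2 ≤ N) (hP : H.HasProfile N')
    {j : ℕ} (hj : 1 ≤ j) (hjN' : j < N') : 0 < H.certificate (j + 1) j := by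
  have h0 : (0 : ℝ) < N := by exact_mod_cast (by omega : 0 < N)
  have h1 : (0 : ℝ) < j := by exact_mod_cast hj
  have h2 := targetPoly_coeff_top_pos hN' hN (by omega : 1 ≤ j + 1)
  rw [H.certificate_eq_of_hasProfile hN' hN hP hj (by omega) (by omega), coeffDot_apply,
    Finset.sum_eq_single (N - (j + 1))]
  · rw [targetPoly_of_lt hjN', coeff_smul, coeff_sub, coeff_X_pow, coeff_X_pow,
      if_neg (by omega), if_pos (by omega), zero_sub, smul_eq_mul, mul_neg_one, mul_neg, mul_neg,
      neg_neg]
    positivity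
  · intro i _ hi
    rcases hi.lt_or_gt with hi | hi
    · rw [targetPoly_of_lt hjN', coeff_smul, coeff_sub, coeff_X_pow, coeff_X_pow,
        if_neg (by omega), if_neg (by omega), sub_self, smul_zero, mul_zero]
    · rw [targetPoly_coeff_gt hN' hN hi, zero_mul]
  · intro h
    exact absurd (Finset.mem_range.2 (by omega)) h

theorem certificate_last_pos (hN' : 2 ≤ N') (hN : N' + 2 ≤ N) (hP : H.HasProfile N')
    {j : ℕ} (hj : N' ≤ j) (hjN : j ≤ N - 1) : 0 < H.certificate N j := by
  have h0 : (0 : ℝ) < N := by exact_mod_cast (by omega : 0 < N)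
  obtain ⟨w, hw0, hw⟩ := exists_targetPoly_eq_smul hN' hN hj
  have h1 : (0 : ℝ) < (N - j : ℕ) := by exact_mod_cast (by omega : 0 < N - j)
  rw [H.certificate_eq_of_hasProfile hN' hN hP (by omega) (by omega) le_rfl,
    targetPoly_self hN, coeffDot_comm, ← pow_zero X, coeffDot_X_pow (by omega), hw, coeff_smul,
    avgDiff_coeff_lt (by omega), smul_eq_mul, mul_neg, mul_neg, neg_neg]
  positivity

/-! ### Existence and uniqueness of the matrix with a given profile -/

/-- The profile fixes `r_j / (X - 1)`, whose coordinates in the basis `r_{j+1}, …, r_N` are the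
partial column sums. -/
theorem eq_of_hasProfile (hN' : 2 ≤ N') (hN : N' + 2 ≤ N) {H H' : HMatrix N} (hH : H.IsLower)
    (hH' : H'.IsLower) (hP : H.HasProfile N') (hP' : H'.HasProfile N') : H = H' := by
  rw [hasProfile_iff _ hN' hN] at hP hP'
  have key : ∀ j, 1 ≤ j → j < N → ∀ k ∈ Finset.Ioc j N, H.colSum k j = H'.colSum k j := by
    intro j hj hjN
    apply (isStaircase_targetPoly hN' hN).eq_of_sum_eq
    have h1 : H.colQuot j = H'.colQuot j := by
      refine mul_left_cancel₀ (X_sub_C_ne_zero (1 : ℝ)) ?_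
      rw [C_1, ← H.colPoly_eq_mul_colQuot hj hjN, ← H'.colPoly_eq_mul_colQuot hj hjN,
        hP j hj hjN.le, hP' j hj hjN.le]
    have h2 : ∀ G : HMatrix N, (∀ j, 1 ≤ j → j ≤ N → G.colPoly j = targetPoly N N' j) →
        G.colQuot j = ∑ k ∈ Finset.Ioc j N, G.colSum k j • targetPoly N N' k := by
      intro G hG
      refine Finset.sum_congr rfl fun k hk => ?_
      rw [Finset.mem_Ioc] at hk
      rw [hG k (by omega) hk.2]
    rw [← h2 H hP, ← h2 H' hP', h1]
  have hentry (G : HMatrix N) {k j : ℕ} (hjk : j ≤ k) :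
      G.entry k j = G.colSum (k + 1) j - G.colSum k j := by
    rw [colSum, colSum, Finset.sum_Ico_succ_top hjk]
    ring
  ext k j
  rcases lt_or_ge k j with hkj | hkj
  · rw [hH k j hkj, hH' k j hkj]
  · have h1 : H.entry (k + 1) (j + 1) = H'.entry (k + 1) (j + 1) := by
      have hkj' : (j : ℕ) ≤ k := hkj
      rw [hentry H (by omega), hentry H' (by omega),
        key _ (by omega) (by omega) _ (Finset.mem_Ioc.2 (by omega))]
      rcases hkj'.eq_or_lt with h | h
      · rw [h, colSum_self, colSum_self]
      · rw [key _ (by omega) (by omega) _ (Finset.mem_Ioc.2 (by omega))]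
    rw [entry, entry, dif_pos (by omega), dif_pos (by omega)] at h1
    exact h1

theorem exists_hasProfile (hN' : 2 ≤ N') (hN : N' + 2 ≤ N) :
    ∃ H : HMatrix N, H.IsLower ∧ H.HasProfile N' := by
  have hr := isStaircase_targetPoly hN' hN
  have hex (j : ℕ) : ∃ a : ℕ → ℝ, 1 ≤ j → j < N → targetPoly N N' j =
      (X - 1) * ∑ k ∈ Finset.Ioc j N, a k • targetPoly N N' k := by
    by_cases hj : 1 ≤ j ∧ j < N
    swap
    · exact ⟨0, fun h1 h2 => absurd ⟨h1, h2⟩ hj⟩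
    obtain ⟨hj, hjN⟩ := hj
    obtain ⟨f, hf⟩ := dvd_iff_isRoot.2 (targetPoly_eval_one hN' hN hjN)
    have hdeg : ∀ i, N - j ≤ i → f.coeff i = 0 := by
      have h1 : (targetPoly N N' j).natDegree ≤ N - j :=
        natDegree_le_iff_coeff_eq_zero.2 fun i hi => targetPoly_coeff_gt hN' hN hi
      intro i hi
      by_contra hfi
      have hf0 : f ≠ 0 := by
        rintro rfl
        simp at hfi
      rw [hf, natDegree_mul (X_sub_C_ne_zero 1) hf0, natDegree_X_sub_C] at h1
      have := le_natDegree_of_ne_zero hfi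
      omega
    obtain ⟨c, hc⟩ := hr.exists_eq_sum hjN.le hdeg
    exact ⟨c, fun _ _ => by rw [hf, hc, C_1]⟩
  choose a ha using hex
  -- `b k j` is the partial column sum, whose increments in `k` are the entries of the matrix
  set b : ℕ → ℕ → ℝ := fun k j => if j < k then a j k else 0 with hb
  set H : HMatrix N := fun k j =>
    if j ≤ k then b (k + 2) (j + 1) - b (k + 1) (j + 1) else 0 with hHdef
  refine ⟨H, fun k j hkj => if_neg (not_le.2 hkj), ?_⟩
  have hentry {k j : ℕ} (hj : 1 ≤ j) (hjk : j ≤ k) (hk : k < N) :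
      H.entry k j = b (k + 1) j - b k j := by
    obtain ⟨k, rfl⟩ : ∃ k', k = k' + 1 := ⟨k - 1, by omega⟩
    obtain ⟨j, rfl⟩ : ∃ j', j = j' + 1 := ⟨j - 1, by omega⟩
    rw [entry, dif_pos (by omega), hHdef]
    exact if_pos (Fin.mk_le_mk.2 (by omega))
  have hcol {k j : ℕ} (hj : 1 ≤ j) (hjk : j ≤ k) (hk : k ≤ N) : H.colSum k j = b k j := by
    have h1 : H.colSum k j = ∑ i ∈ Finset.Ico j k, (b (i + 1) j - b i j) := by
      refine Finset.sum_congr rfl fun i hi => ?_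
      rw [Finset.mem_Ico] at hi
      exact hentry hj hi.1 (by omega)
    rw [h1, Finset.sum_Ico_sub (fun i => b i j) hjk]
    simp [hb]
  rw [hasProfile_iff _ hN' hN]
  intro j hj hjN
  induction hn : N - j using Nat.strong_induction_on generalizing j with
  | _ n ih =>
    rcases hjN.eq_or_lt with rfl | hjN
    · rw [H.colPoly_self hj, targetPoly_self hN]
    · rw [H.colPoly_eq_mul_colQuot hj hjN, ha j hj hjN, colQuot]
      congr 1
      refine Finset.sum_congr rfl fun k hk => ?_
      rw [Finset.mem_Ioc] at hk
      rw [hcol hj (by omega) hk.2, ih (N - k) (by omega) k (by omega) hk.2 rfl]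
      simp [hb, hk.1]

theorem existsUnique_hasProfile (hN' : 2 ≤ N') (hN : N' + 2 ≤ N) :
    ∃! H : HMatrix N, H.IsLower ∧ H.HasProfile N' := by
  obtain ⟨H, hH⟩ := exists_hasProfile hN' hN
  exact ⟨H, hH, fun H' hH' => eq_of_hasProfile hN' hN hH'.1 hH.1 hH'.2 hH.2⟩

end HMatrix

end

/-! ### The worst-case guarantee -/

theorem DetAlgorithm.iterate_succ {d : ℕ} (A : DetAlgorithm d)
    (T : EuclideanSpace ℝ (Fin d) → EuclideanSpace ℝ (Fin d)) (y₀ : EuclideanSpace ℝ (Fin d))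
    (k : ℕ) : A.iterate T y₀ (k + 1) =
      A k (fun i : Fin (k + 1) => (A.iterate T y₀ i, T (A.iterate T y₀ i))) := by
  rw [DetAlgorithm.iterate]

theorem DetAlgorithm.iterate_zero {d : ℕ} (A : DetAlgorithm d)
    (T : EuclideanSpace ℝ (Fin d) → EuclideanSpace ℝ (Fin d)) (y₀ : EuclideanSpace ℝ (Fin d)) :
    A.iterate T y₀ 0 = y₀ := by
  rw [DetAlgorithm.iterate]

/-- For nonexpansive `T` the map `y - (y - T y) / 2 ↦ (y - T y) / 2` is monotone. -/
theorem LipschitzWith.inner_half_sub_nonneg {E : Type*} [NormedAddCommGroup E]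
    [InnerProductSpace ℝ E] {T : E → E} (hT : LipschitzWith 1 T) (a b : E) :
    0 ≤ inner ℝ ((a - (1 / 2 : ℝ) • (a - T a)) - (b - (1 / 2 : ℝ) • (b - T b)))
      ((1 / 2 : ℝ) • (a - T a) - (1 / 2 : ℝ) • (b - T b)) := by
  have h1 : ‖T a - T b‖ ≤ ‖a - b‖ := by simpa [dist_eq_norm] using hT.dist_le_mul a b
  have h2 : (a - (1 / 2 : ℝ) • (a - T a)) - (b - (1 / 2 : ℝ) • (b - T b)) =
      (1 / 2 : ℝ) • ((a - b) + (T a - T b)) := by module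
  have h3 : (1 / 2 : ℝ) • (a - T a) - (1 / 2 : ℝ) • (b - T b) =
      (1 / 2 : ℝ) • ((a - b) - (T a - T b)) := by module
  have h4 (u v : E) : inner ℝ (u + v) (u - v) = ‖u‖ ^ 2 - ‖v‖ ^ 2 := by
    rw [inner_add_left, inner_sub_right, inner_sub_right, real_inner_self_eq_norm_sq,
      real_inner_self_eq_norm_sq, real_inner_comm v u]
    ring
  rw [h2, h3, inner_smul_left, inner_smul_right, h4]
  have h5 : ‖T a - T b‖ ^ 2 ≤ ‖a - b‖ ^ 2 := by gcongr
  simp only [conj_trivial]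
  linarith

namespace HMatrix

variable {N : ℕ} (H : HMatrix N)

theorem formalY_eq_iterate {d : ℕ} (T : EuclideanSpace ℝ (Fin d) → EuclideanSpace ℝ (Fin d))
    (y₀ : EuclideanSpace ℝ (Fin d)) (k : ℕ) :
    H.formalY y₀ (fun k => (1 / 2 : ℝ) • ((H.toAlgorithm d).iterate T y₀ (k - 1) -
      T ((H.toAlgorithm d).iterate T y₀ (k - 1)))) k = (H.toAlgorithm d).iterate T y₀ k := by
  induction k with
  | zero => rw [formalY, DetAlgorithm.iterate_zero]
  | succ k ih =>
    rw [formalY, ih, DetAlgorithm.iterate_succ]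
    simp only [toAlgorithm, Fin.val_last, Nat.add_sub_cancel, smul_smul]
    rw [Finset.sum_range]
    congr 1
    refine Finset.sum_congr rfl fun j _ => ?_
    congr 1
    ring

/-- With nonnegative multipliers the certificate identity gives `N ‖g_N‖² ≤ ⟪g_N, y_0 - y_*⟫`. -/
theorem IsCertificate.norm_sub_sq_le {lam : ℕ → ℕ → ℝ} (h : H.IsCertificate lam) (hN : 1 ≤ N)
    (hlam : ∀ k j, 0 ≤ lam k j) {d : ℕ}
    (T : EuclideanSpace ℝ (Fin d) → EuclideanSpace ℝ (Fin d)) (y₀ yStar : EuclideanSpace ℝ (Fin d))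
    (hT : LipschitzWith 1 T) (hfix : T yStar = yStar) :
    ‖(H.toAlgorithm d).iterate T y₀ (N - 1) - T ((H.toAlgorithm d).iterate T y₀ (N - 1))‖ ^ 2 ≤
      4 * ‖y₀ - yStar‖ ^ 2 / (N : ℝ) ^ 2 := by
  set y := (H.toAlgorithm d).iterate T y₀ with hy
  set g : ℕ → EuclideanSpace ℝ (Fin d) := fun k => (1 / 2 : ℝ) • (y (k - 1) - T (y (k - 1)))
    with hg
  have hx (k : ℕ) : H.formalX y₀ g k = y (k - 1) - g k := by
    rw [formalX, hg, H.formalY_eq_iterate T y₀]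
  have h1 := h.2 d y₀ g
  have h2 : 0 ≤ ∑ k ∈ Finset.Icc 1 N, ∑ j ∈ Finset.Icc 1 (k - 1),
      lam k j * inner ℝ (H.formalX y₀ g k - H.formalX y₀ g j) (g k - g j) := by
    refine Finset.sum_nonneg fun k _ => Finset.sum_nonneg fun j _ => mul_nonneg (hlam k j) ?_
    rw [hx, hx]
    exact hT.inner_half_sub_nonneg _ _
  have h3 : 0 ≤ inner ℝ (g N) (H.formalX y₀ g N - yStar) := by
    have := hT.inner_half_sub_nonneg (y (N - 1)) yStar
    rw [hfix, sub_self, smul_zero, sub_zero, sub_zero, real_inner_comm] at this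
    rw [hx]
    exact this
  have h4 : inner ℝ (g N) (H.formalX y₀ g N - y₀) =
      inner ℝ (g N) (H.formalX y₀ g N - yStar) - inner ℝ (g N) (y₀ - yStar) := by
    rw [← inner_sub_right]
    congr 1
    abel
  have h5 := real_inner_le_norm (g N) (y₀ - yStar)
  have hN0 : (0 : ℝ) < N := by exact_mod_cast hN
  have h6 : N * ‖g N‖ ≤ ‖y₀ - yStar‖ := by
    rcases (norm_nonneg (g N)).eq_or_lt with h0 | h0
    · rw [← h0, mul_zero]
      exact norm_nonneg _
    · refine le_of_mul_le_mul_left ?_ h0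
      nlinarith
  have h7 : ‖y (N - 1) - T (y (N - 1))‖ = 2 * ‖g N‖ := by
    rw [hg, norm_smul, Real.norm_of_nonneg (by norm_num)]
    ring
  rw [h7, le_div_iff₀ (by positivity)]
  nlinarith [norm_nonneg (g N), mul_nonneg hN0.le (norm_nonneg (g N))]

theorem certificate_nonneg_of_hasProfile {N' : ℕ} (hN' : 2 ≤ N') (hN : N' + 2 ≤ N)
    (hP : H.HasProfile N') (k j : ℕ) : 0 ≤ H.certificate k j := by
  by_cases hkj : 1 ≤ j ∧ j < k ∧ k ≤ N
  · rcases lt_or_ge j N' with hj | hj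
    · rcases eq_or_ne k (j + 1) with rfl | hk
      · exact (H.certificate_succ_pos hN' hN hP hkj.1 hj).le
      · exact (H.topSparse_of_hasProfile hN' hN hP hkj.1 hj k (by omega) hkj.2.2).ge
    · rcases eq_or_ne k N with rfl | hk
      · exact (H.certificate_last_pos hN' hN hP hj (by omega)).le
      · exact (H.bottomSparse_of_hasProfile hN' hN hP hj k (by omega) (by omega)).ge
  · rw [H.certificate_eq_gramCert (by omega) (H.isInvariant_of_hasProfile hN' hN hP), gramCert,
      if_neg hkj]

theorem norm_sub_sq_le_of_hasProfile {N' : ℕ} (hN' : 2 ≤ N') (hN : N' + 2 ≤ N)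
    (hP : H.HasProfile N') {d : ℕ}
    (T : EuclideanSpace ℝ (Fin d) → EuclideanSpace ℝ (Fin d)) (y₀ yStar : EuclideanSpace ℝ (Fin d))
    (hT : LipschitzWith 1 T) (hfix : T yStar = yStar) :
    ‖(H.toAlgorithm d).iterate T y₀ (N - 1) - T ((H.toAlgorithm d).iterate T y₀ (N - 1))‖ ^ 2 ≤
      4 * ‖y₀ - yStar‖ ^ 2 / (N : ℝ) ^ 2 := by
  refine IsCertificate.norm_sub_sq_le H (lam := H.certificate) ?_ (by omega)
    (H.certificate_nonneg_of_hasProfile hN' hN hP) T y₀ yStar hT hfix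
  have hI := H.isInvariant_of_hasProfile hN' hN hP
  rw [H.certificate_eq_gramCert (by omega) hI]
  exact H.gramCert_isCertificate (by omega) hI

theorem worstCase_le_of_hasProfile {N' : ℕ} (hN' : 2 ≤ N') (hN : N' + 2 ≤ N)
    (hP : H.HasProfile N') (d : ℕ) :
    (H.toAlgorithm d).worstCase N ≤ ENNReal.ofReal (4 / (N : ℝ) ^ 2) := by
  refine iSup_le fun p => ENNReal.ofReal_le_ofReal ?_
  have h0 : 0 < ‖p.y₀ - p.yStar‖ := norm_pos_iff.2 (sub_ne_zero.2 p.start_ne)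
  rw [div_le_iff₀ (by positivity), div_mul_eq_mul_div]
  exact H.norm_sub_sq_le_of_hasProfile hN' hN hP p.T p.y₀ p.yStar p.nonexpansive p.fixed

end HMatrix

/-! ### The lower bound for deterministic algorithms -/

section

variable {E : Type*} [NormedAddCommGroup E] [InnerProductSpace ℝ E]

theorem exists_norm_eq_one_inner_eq_zero [FiniteDimensional ℝ E] {s : Finset E}
    (hs : s.card < Module.finrank ℝ E) : ∃ v : E, ‖v‖ = 1 ∧ ∀ x ∈ s, inner ℝ v x = 0 := by
  have h1 : Submodule.span ℝ (s : Set E) ≠ ⊤ := by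
    intro h
    have h2 := finrank_span_finset_le_card (R := ℝ) s
    rw [Set.finrank, h, finrank_top] at h2
    omega
  obtain ⟨w, hw, hw0⟩ := Submodule.exists_mem_ne_zero_of_ne_bot
    (fun h => h1 ((Submodule.orthogonal_eq_bot_iff).1 h))
  refine ⟨‖w‖⁻¹ • w, ?_, fun x hx => ?_⟩
  · rw [norm_smul, norm_inv, norm_norm, inv_mul_cancel₀ (norm_ne_zero_iff.2 hw0)]
  · rw [inner_smul_left, real_inner_comm,
      (Submodule.mem_orthogonal _ _).1 hw x (Submodule.subset_span hx), mul_zero]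

/-- The first `m` members of a sequence are orthonormal. -/
def OrthonormalBelow (e : ℕ → E) (m : ℕ) : Prop :=
  ∀ i < m, ∀ j < m, inner ℝ (e i) (e j) = if i = j then (1 : ℝ) else 0

namespace OrthonormalBelow

variable {e : ℕ → E} {m : ℕ}

theorem inner_sum_right (he : OrthonormalBelow e m) (a : ℕ → ℝ) {i : ℕ} (hi : i < m) :
    inner ℝ (e i) (∑ j ∈ Finset.range m, a j • e j) = a i := by
  rw [inner_sum, Finset.sum_eq_single i]
  · rw [inner_smul_right, he i hi i hi, if_pos rfl, mul_one]
  · intro j hj hji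
    rw [inner_smul_right, he i hi j (Finset.mem_range.1 hj), if_neg hji.symm, mul_zero]
  · intro h
    exact absurd (Finset.mem_range.2 hi) h

theorem inner_sum_sum (he : OrthonormalBelow e m) (a b : ℕ → ℝ) :
    inner ℝ (∑ i ∈ Finset.range m, a i • e i) (∑ j ∈ Finset.range m, b j • e j) =
      ∑ i ∈ Finset.range m, a i * b i := by
  rw [sum_inner]
  refine Finset.sum_congr rfl fun i hi => ?_
  rw [inner_smul_left, he.inner_sum_right b (Finset.mem_range.1 hi)]
  rfl

theorem sum_inner_sq_le (he : OrthonormalBelow e m) (x : E) :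
    ∑ i ∈ Finset.range m, inner ℝ (e i) x ^ 2 ≤ ‖x‖ ^ 2 := by
  have h1 := sq_nonneg ‖x - ∑ i ∈ Finset.range m, inner ℝ (e i) x • e i‖
  have h2 : inner ℝ x (∑ i ∈ Finset.range m, inner ℝ (e i) x • e i) =
      ∑ i ∈ Finset.range m, inner ℝ (e i) x ^ 2 := by
    rw [inner_sum]
    refine Finset.sum_congr rfl fun i _ => ?_
    rw [inner_smul_right, real_inner_comm, sq]
  rw [norm_sub_sq_real, h2, ← real_inner_self_eq_norm_sq (∑ i ∈ _, _), he.inner_sum_sum] at h1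
  simp only [← sq] at h1
  linarith

theorem update (he : OrthonormalBelow e m) {v : E} (hv : ‖v‖ = 1)
    (hve : ∀ i < m, inner ℝ v (e i) = 0) : OrthonormalBelow (Function.update e m v) (m + 1) := by
  intro i hi j hj
  rcases eq_or_ne i m with him | him <;> rcases eq_or_ne j m with hjm | hjm
  · rw [him, hjm, Function.update_self, real_inner_self_eq_norm_sq, hv, if_pos rfl, one_pow]
  · rw [him, Function.update_self, Function.update_of_ne hjm, hve j (by omega), if_neg hjm.symm]
  · rw [hjm, Function.update_self, Function.update_of_ne him, real_inner_comm, hve i (by omega),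
      if_neg him]
  · rw [Function.update_of_ne him, Function.update_of_ne hjm, he i (by omega) j (by omega)]

end OrthonormalBelow

/-- The affine shift `y ↦ e_0 + ∑_{i < n} ⟪e_i, y⟫ e_{i+1}`. -/
def shiftMap (e : ℕ → E) (n : ℕ) (y : E) : E :=
  e 0 + ∑ i ∈ Finset.range n, inner ℝ (e i) y • e (i + 1)

/-- The affine cyclic shift `y ↦ e_0 + ∑_{i < n} ⟪e_i, y⟫ e_{i+1} - ⟪e_n, y⟫ e_0`. -/
def cyclicMap (e : ℕ → E) (n : ℕ) (y : E) : E := shiftMap e n y - inner ℝ (e n) y • e 0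

theorem shiftMap_update (e : ℕ → E) (n : ℕ) (v y : E) :
    shiftMap (Function.update e (n + 1) v) (n + 1) y = shiftMap e n y + inner ℝ (e n) y • v := by
  rw [shiftMap, shiftMap, Finset.sum_range_succ, Function.update_self,
    Function.update_of_ne (by omega), Function.update_of_ne (by omega), ← add_assoc]
  congr 2
  refine Finset.sum_congr rfl fun i hi => ?_
  rw [Finset.mem_range] at hi
  rw [Function.update_of_ne (by omega), Function.update_of_ne (by omega)]

variable {e : ℕ → E} {n : ℕ}

theorem lipschitzWith_cyclicMap (he : OrthonormalBelow e (n + 1)) :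
    LipschitzWith 1 (cyclicMap e n) := by
  refine LipschitzWith.of_dist_le_mul fun a b => ?_
  rw [NNReal.coe_one, one_mul, dist_eq_norm, dist_eq_norm]
  let c : ℕ → ℝ := fun i => Nat.casesOn i (-inner ℝ (e n) (a - b)) fun i => inner ℝ (e i) (a - b)
  have hc0 : c 0 = -inner ℝ (e n) (a - b) := rfl
  have hcs (i : ℕ) : c (i + 1) = inner ℝ (e i) (a - b) := rfl
  have h1 : cyclicMap e n a - cyclicMap e n b = ∑ i ∈ Finset.range (n + 1), c i • e i := by
    rw [Finset.sum_range_succ']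
    simp only [hc0, hcs, cyclicMap, shiftMap, inner_sub_right, sub_smul, neg_smul,
      Finset.sum_sub_distrib]
    abel
  refine le_of_sq_le_sq ?_ (norm_nonneg _)
  rw [h1, ← real_inner_self_eq_norm_sq, he.inner_sum_sum, Finset.sum_range_succ']
  refine le_trans (le_of_eq ?_) (he.sum_inner_sq_le (a - b))
  rw [Finset.sum_range_succ]
  simp only [hc0, hcs]
  congr 1
  · exact Finset.sum_congr rfl fun i _ => (sq _).symm
  · ring

/-- Half the sum of the basis vectors is fixed: the wrap-around term turns `e_0` into `e_0 / 2`. -/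
theorem cyclicMap_fixed (he : OrthonormalBelow e (n + 1)) :
    cyclicMap e n (∑ i ∈ Finset.range (n + 1), (1 / 2 : ℝ) • e i) =
      ∑ i ∈ Finset.range (n + 1), (1 / 2 : ℝ) • e i := by
  have h1 : ∀ i < n + 1, inner ℝ (e i) (∑ i ∈ Finset.range (n + 1), (1 / 2 : ℝ) • e i) = 1 / 2 :=
    fun i hi => he.inner_sum_right (fun _ => 1 / 2) hi
  rw [cyclicMap, shiftMap, h1 n (by omega)]
  rw [Finset.sum_congr rfl fun i hi => by
    rw [h1 i (by rw [Finset.mem_range] at hi; omega)]]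
  rw [Finset.sum_range_succ' _ n]
  module

/-- Testing the residual against `e_0 + ⋯ + e_n`, which telescopes. -/
theorem one_le_mul_norm_sub_cyclicMap_sq (he : OrthonormalBelow e (n + 1)) {y : E}
    (hy : inner ℝ (e n) y ≤ 0) : 1 ≤ ((n : ℝ) + 1) * ‖y - cyclicMap e n y‖ ^ 2 := by
  set s := ∑ i ∈ Finset.range (n + 1), (1 : ℝ) • e i with hs
  have hse : ∀ i < n + 1, inner ℝ (e i) s = 1 := fun i hi => he.inner_sum_right (fun _ => 1) hi
  have h1 : inner ℝ y s = ∑ i ∈ Finset.range n, inner ℝ (e i) y + inner ℝ (e n) y := by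
    rw [← Finset.sum_range_succ fun i => inner ℝ (e i) y, hs, inner_sum]
    refine Finset.sum_congr rfl fun i _ => ?_
    rw [one_smul, real_inner_comm]
  have h2 : inner ℝ (cyclicMap e n y) s =
      1 + ∑ i ∈ Finset.range n, inner ℝ (e i) y - inner ℝ (e n) y := by
    rw [cyclicMap, shiftMap, inner_sub_left, inner_add_left, sum_inner, inner_smul_left,
      hse 0 (by omega), conj_trivial, mul_one]
    congr 2
    refine Finset.sum_congr rfl fun i hi => ?_
    rw [Finset.mem_range] at hi
    rw [inner_smul_left, hse _ (by omega), conj_trivial, mul_one]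
  have h3 : ‖s‖ ^ 2 = n + 1 := by
    rw [← real_inner_self_eq_norm_sq, hs, he.inner_sum_sum]
    simp
  have h4 : inner ℝ (y - cyclicMap e n y) s ≤ -1 := by
    rw [inner_sub_left, h1, h2]
    linarith
  have h5 := abs_real_inner_le_norm (y - cyclicMap e n y) s
  have h6 : 1 ≤ ‖y - cyclicMap e n y‖ * ‖s‖ := by
    refine le_trans ?_ h5
    rw [abs_of_nonpos (by linarith)]
    linarith
  calc (1 : ℝ) ≤ (‖y - cyclicMap e n y‖ * ‖s‖) ^ 2 := one_le_pow₀ h6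
    _ = _ := by rw [mul_pow, h3, mul_comm]

end

namespace DetAlgorithm

variable {d : ℕ} (A : DetAlgorithm d)

/-- The iterates depend on the operator only through its values at the earlier iterates. -/
theorem iterate_congr {T T' : EuclideanSpace ℝ (Fin d) → EuclideanSpace ℝ (Fin d)}
    {y₀ : EuclideanSpace ℝ (Fin d)} {n : ℕ}
    (h : ∀ k < n, T' (A.iterate T y₀ k) = T (A.iterate T y₀ k)) :
    ∀ k ≤ n, A.iterate T' y₀ k = A.iterate T y₀ k := by
  intro k
  induction k using Nat.strong_induction_on with
  | _ k ih =>
    intro hk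
    rcases k with _ | k
    · rw [iterate_zero, iterate_zero]
    · rw [iterate_succ, iterate_succ]
      congr 1
      funext i
      rw [ih i i.isLt (by omega), h i (by omega)]

/-- The resisting oracle: the orthonormal vectors are chosen one by one, each orthogonal to the
iterates computed so far. -/
theorem exists_orthonormalBelow (n : ℕ) (hd : 2 * n < d) :
    ∃ e : ℕ → EuclideanSpace ℝ (Fin d), OrthonormalBelow e (n + 1) ∧
      ∀ k i, k ≤ i → i ≤ n → inner ℝ (e i) (A.iterate (shiftMap e n) 0 k) = 0 := by
  induction n with
  | zero =>
    obtain ⟨v, hv, -⟩ := exists_norm_eq_one_inner_eq_zero (E := EuclideanSpace ℝ (Fin d))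
      (s := ∅) (by simpa using hd)
    refine ⟨fun _ => v, ?_, ?_⟩
    · intro i hi j hj
      rw [real_inner_self_eq_norm_sq, hv, if_pos (by omega), one_pow]
    · intro k i hki hi
      obtain rfl : k = 0 := by omega
      rw [iterate_zero, inner_zero_right]
  | succ n ih =>
    obtain ⟨e, he, hy⟩ := ih (by omega)
    set y := A.iterate (shiftMap e n) 0 with hydef
    -- the iterate `y 0 = 0` imposes no condition on the new vector, so that `2 (n + 1)`
    -- orthogonality conditions remain
    obtain ⟨v, hv, hvs⟩ := exists_norm_eq_one_inner_eq_zero (E := EuclideanSpace ℝ (Fin d))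
      (s := (Finset.range (n + 1)).image e ∪ (Finset.Icc 1 (n + 1)).image y) (by
        refine lt_of_le_of_lt (Finset.card_union_le _ _) ?_
        have h1 := Finset.card_image_le (s := Finset.range (n + 1)) (f := e)
        have h2 := Finset.card_image_le (s := Finset.Icc 1 (n + 1)) (f := y)
        rw [Finset.card_range] at h1
        rw [Nat.card_Icc] at h2
        rw [finrank_euclideanSpace_fin]
        omega)
    have hve : ∀ i < n + 1, inner ℝ v (e i) = 0 := fun i hi =>
      hvs _ (Finset.mem_union_left _ (Finset.mem_image_of_mem _ (Finset.mem_range.2 hi)))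
    have hvy : ∀ k ≤ n + 1, inner ℝ v (y k) = 0 := by
      intro k hk
      rcases Nat.eq_zero_or_pos k with rfl | hk0
      · rw [hydef, iterate_zero, inner_zero_right]
      · exact hvs _ (Finset.mem_union_right _ (Finset.mem_image_of_mem _
          (Finset.mem_Icc.2 ⟨hk0, hk⟩)))
    have hiter := A.iterate_congr (T := shiftMap e n)
      (T' := shiftMap (Function.update e (n + 1) v) (n + 1)) (y₀ := 0) (n := n + 1) (by
        intro k hk
        rw [shiftMap_update, ← hydef, hy k n (by omega) le_rfl, zero_smul, add_zero])
    refine ⟨Function.update e (n + 1) v, he.update hv hve, fun k i hki hi => ?_⟩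
    rw [hiter k (by omega), ← hydef]
    rcases hi.eq_or_lt with rfl | hi
    · rw [Function.update_self, hvy k hki]
    · rw [Function.update_of_ne (by omega), hy k i hki (by omega)]

/-- No deterministic algorithm beats `4 / N²` in dimension `2 (N - 1)` or higher. -/
theorem le_worstCase {N : ℕ} (hN : 2 ≤ N) (hd : 2 * (N - 1) ≤ d) :
    ENNReal.ofReal (4 / (N : ℝ) ^ 2) ≤ A.worstCase N := by
  obtain ⟨n, rfl⟩ : ∃ n, N = n + 2 := ⟨N - 2, by omega⟩
  obtain ⟨e, he, hy⟩ := A.exists_orthonormalBelow n (by omega)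
  set y := A.iterate (shiftMap e n) 0 with hydef
  obtain ⟨v, hv, hvs⟩ := exists_norm_eq_one_inner_eq_zero (E := EuclideanSpace ℝ (Fin d))
    (s := (Finset.range (n + 1)).image e ∪ (Finset.Icc 1 n).image y) (by
      refine lt_of_le_of_lt (Finset.card_union_le _ _) ?_
      have h1 := Finset.card_image_le (s := Finset.range (n + 1)) (f := e)
      have h2 := Finset.card_image_le (s := Finset.Icc 1 n) (f := y)
      rw [Finset.card_range] at h1
      rw [Nat.card_Icc] at h2
      rw [finrank_euclideanSpace_fin]
      omega)
  -- The last vector need not be orthogonal to the output; the sign of its coefficient suffices.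
  -- This saves one dimension.
  obtain ⟨w, hw, hwe, hwy, hwn⟩ : ∃ w : EuclideanSpace ℝ (Fin d), ‖w‖ = 1 ∧
      (∀ i < n + 1, inner ℝ w (e i) = 0) ∧ (∀ k ≤ n, inner ℝ w (y k) = 0) ∧
      inner ℝ w (y (n + 1)) ≤ 0 := by
    have hve : ∀ i < n + 1, inner ℝ v (e i) = 0 := fun i hi =>
      hvs _ (Finset.mem_union_left _ (Finset.mem_image_of_mem _ (Finset.mem_range.2 hi)))
    have hvy : ∀ k ≤ n, inner ℝ v (y k) = 0 := by
      intro k hk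
      rcases Nat.eq_zero_or_pos k with rfl | hk0
      · rw [hydef, iterate_zero, inner_zero_right]
      · exact hvs _ (Finset.mem_union_right _ (Finset.mem_image_of_mem _
          (Finset.mem_Icc.2 ⟨hk0, hk⟩)))
    rcases le_total (inner ℝ v (y (n + 1))) 0 with h | h
    · exact ⟨v, hv, hve, hvy, h⟩
    · refine ⟨-v, by rw [norm_neg, hv], fun i hi => ?_, fun k hk => ?_, ?_⟩
      · rw [inner_neg_left, hve i hi, neg_zero]
      · rw [inner_neg_left, hvy k hk, neg_zero]
      · rw [inner_neg_left]
        linarith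
  set e' := Function.update e (n + 1) w with he'
  have hon : OrthonormalBelow e' (n + 1 + 1) := he.update hw hwe
  have hiter := A.iterate_congr (T := shiftMap e n) (T' := cyclicMap e' (n + 1)) (y₀ := 0)
    (n := n + 1) (by
      intro k hk
      rw [cyclicMap, he', shiftMap_update, ← hydef, hy k n (by omega) le_rfl, Function.update_self,
        hwy k (by omega), zero_smul, zero_smul, add_zero, sub_zero])
  have hnorm : ‖∑ i ∈ Finset.range (n + 1 + 1), (1 / 2 : ℝ) • e' i‖ ^ 2 = ((n : ℝ) + 2) / 4 := by
    rw [← real_inner_self_eq_norm_sq, hon.inner_sum_sum, Finset.sum_const, Finset.card_range,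
      nsmul_eq_mul]
    push_cast
    ring
  have hn : (0 : ℝ) < n + 2 := by positivity
  let p : FixedPointProblem d :=
    { T := cyclicMap e' (n + 1)
      nonexpansive := lipschitzWith_cyclicMap hon
      y₀ := 0
      yStar := ∑ i ∈ Finset.range (n + 1 + 1), (1 / 2 : ℝ) • e' i
      fixed := cyclicMap_fixed hon
      start_ne := by
        intro h
        rw [← h, norm_zero] at hnorm
        norm_num at hnorm
        linarith }
  refine le_trans (ENNReal.ofReal_le_ofReal ?_)
    (le_iSup (fun p : FixedPointProblem d => ENNReal.ofReal
      (‖A.iterate p.T p.y₀ (n + 2 - 1) - p.T (A.iterate p.T p.y₀ (n + 2 - 1))‖ ^ 2 /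
        ‖p.y₀ - p.yStar‖ ^ 2)) p)
  change _ ≤ ‖A.iterate (cyclicMap e' (n + 1)) 0 (n + 1) -
    cyclicMap e' (n + 1) (A.iterate (cyclicMap e' (n + 1)) 0 (n + 1))‖ ^ 2 / ‖0 - p.yStar‖ ^ 2
  rw [hiter (n + 1) le_rfl, ← hydef, zero_sub, norm_neg, hnorm]
  have key := one_le_mul_norm_sub_cyclicMap_sq hon (y := y (n + 1))
    (by rw [he', Function.update_self]; exact hwn)
  push_cast at key ⊢
  rw [div_le_div_iff₀ (by positivity) (by positivity)]
  nlinarith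

end DetAlgorithm

theorem mainTheorem6 (N N' : ℕ) (hN' : 2 ≤ N') (hN : N' + 2 ≤ N) :
    -- the H-certificates are well defined under H-invariance
    (∀ H : HMatrix N, H.IsLower → H.IsInvariant → ∃! lam, H.IsCertificate lam) ∧
    -- the sparsity pattern and H-invariance pin down exactly the explicit Q-profile
    (∀ H : HMatrix N, H.IsLower →
      ((H.IsInvariant ∧
          (∀ j : ℕ, 1 ≤ j → j < N' → H.TopSparse j) ∧
          (∀ j : ℕ, N' ≤ j → j ≤ N - 1 → H.BottomSparse j)) ↔
        H.HasProfile N')) ∧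
    -- exactly one H-matrix has this profile
    (∃! H : HMatrix N, H.IsLower ∧ H.HasProfile N') ∧
    -- positivity of the remaining certificates and minimax optimality
    (∀ H : HMatrix N, H.IsLower → H.HasProfile N' →
      (∀ j : ℕ, 1 ≤ j → j < N' → 0 < H.certificate (j + 1) j) ∧
      (∀ j : ℕ, N' ≤ j → j ≤ N - 1 → 0 < H.certificate N j) ∧
      (∀ (d : ℕ) (T : EuclideanSpace ℝ (Fin d) → EuclideanSpace ℝ (Fin d))
          (y₀ yStar : EuclideanSpace ℝ (Fin d)),
        LipschitzWith 1 T → T yStar = yStar →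
          ‖(H.toAlgorithm d).iterate T y₀ (N - 1) -
              T ((H.toAlgorithm d).iterate T y₀ (N - 1))‖ ^ 2 ≤
            4 * ‖y₀ - yStar‖ ^ 2 / (N : ℝ) ^ 2) ∧
      (∀ d : ℕ, 2 * (N - 1) ≤ d →
        (H.toAlgorithm d).worstCase N = ENNReal.ofReal (4 / (N : ℝ) ^ 2) ∧
        (H.toAlgorithm d).IsMinimaxOptimal N)) := by
  refine ⟨fun H _ hI => H.existsUnique_isCertificate (by omega) hI, fun H _ => ⟨?_, fun hP => ?_⟩,
    HMatrix.existsUnique_hasProfile hN' hN, fun H _ hP => ⟨?_, ?_, ?_, ?_⟩⟩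
  · rintro ⟨hI, htop, hbot⟩
    exact H.hasProfile_of_sparse hN' hN hI htop hbot
  · exact ⟨H.isInvariant_of_hasProfile hN' hN hP,
      fun j hj hjN' => H.topSparse_of_hasProfile hN' hN hP hj hjN',
      fun j hj _ => H.bottomSparse_of_hasProfile hN' hN hP hj⟩
  · exact fun j hj hjN' => H.certificate_succ_pos hN' hN hP hj hjN'
  · exact fun j hj hjN => H.certificate_last_pos hN' hN hP hj hjN
  · exact fun d T y₀ yStar hT hfix => H.norm_sub_sq_le_of_hasProfile hN' hN hP T y₀ yStar hT hfix
  · intro d hd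
    have hle := H.worstCase_le_of_hasProfile hN' hN hP d
    exact ⟨le_antisymm hle (DetAlgorithm.le_worstCase _ (by omega) hd),
      fun B => hle.trans (B.le_worstCase (by omega) hd)⟩
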